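/- **Setting.** Let $R>0$, $\gamma\in(0,R/2)$, let $d\ge 2$ be even, $M:=\lceil \pi R/\gamma\rceil$, $a_k:=R(\cos(2\pi k/M),\sin(2\pi k/M))$ for $0\le k<M$, $\mathcal V:=\{a_0,\dots,a_{M-1}\}^{d/2}\subset\mathbb R^d$, and let $U$ be the uniform law on $\mathcal V$. A codebook of size $n\ge1$ is $S=(Y^{(1)},\dots,Y^{(n)})$ with $Y^{(i)}$ i.i.d. from $U$; $\mathbb P_S$ is its law, $\nu_S:=\frac1n\sum_i\delta_{Y^{(i)}}$, and $\kappa(n):=\frac1d\log n$. For $\tau>0$ let $\varphi_{\tau^2}$ be the density of $\mathcal N(0,\tau^2I_d)$, let $\nu_{S,\tau}:=\nu_S*\mathcal N(0,\tau^2I_d)$, let $u_\tau$ be the density of $U*\mathcal N(0,\tau^2I_d)$, and let $s_{S,\tau}$, $s_{U,\tau}$ be the gradients of the log-densities of $\nu_{S,\tau}$ and $U*\mathcal N(0,\tau^2I_d)$. Put $$\ell_\tau(y,x):=\log\frac{\varphi_{\tau^2}(x-y)}{u_\tau(x)},\qquad \ell_\tau:=\ell_\tau(Y,Y+Z),\qquad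 I_\tau:=\tfrac1d\,\mathbb E[\ell_\tau],$$ where $Y\sim U$ and $Z\sim\mathcal N(0,\tau^2I_d)$ are independent, and $$J_\tau(S):=\mathbb E_{X\sim\nu_{S,\tau}}\big[\|s_{S,\tau}(X)-s_{U,\tau}(X)\|_2^2\big].$$ Let $Q\ge1$ be an integer, $\rho\in(0,1/4)$, $\delta:=\rho^2/(80Q)$, and let $\zeta(\tau)\in(0,1/2]$ and $\theta(\tau)>0$ be arbitrary functions of $\tau\ge\gamma$. Let $\Lambda_\tau:=\inf\{\lambda>0:\mathbb P[\ell_\tau\le\log\lambda]\ge\zeta(\tau)\}$, $\psi(t):=\max\{0,\min\{1,t\}\}$, $m_{\tau,S}(x):=\psi\big(\max_{y\in S}\ell_\tau(y,x)-\log\Lambda_\tau+1\big)$, and define the oracle $$\widehat s^{(S)}_\tau(x):=\begin{cases}s_{U,\tau}(x), & J_\tau(S)\le\theta(\tau),\\ s_{U,\tau}(x)+m_{\tau,S}(x)\,\big(s_{S,\tau}(x)-s_{U,\tau}(x)\big), & J_\tau(S)>\theta(\tau).\end{cases}$$ For a constant $C>0$ let $\widetilde\tau:=\tau\sqrt{1-\gamma^2/(R^2d^2)}$,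 $$H(\tau):=\max\Big\{1,\ \log\Big(\frac{\log(1+|\mathcal V|)}{\delta}\cdot\frac{CR^2d^2}{\gamma^2\tau^2\theta(\tau)}\Big)\Big\},$$ $$E_{\mathrm{med}}(\tau):=C\sqrt{dH(\tau)}+CH(\tau),\qquad E_{\mathrm{big}}(\tau):=C\frac{R}{\widetilde\tau}\sqrt{dH(\tau)}+CH(\tau),$$ $$\kappa_+(\tau):=I_{\widetilde\tau}+\tfrac1d\min\{E_{\mathrm{med}}(\tau),E_{\mathrm{big}}(\tau)\}.$$ **Theorem (large-sample agreement with the null score).** There are universal constants $C_0>0$ and $d_0$ such that for every $C\ge C_0$, every even $d\ge d_0$, all $R,\gamma,Q,\rho,\zeta,\theta$ as above, every $\tau\ge\gamma$ and every integer $n\ge1$ with $\kappa(n)\ge\kappa_+(\tau)$, one has $$\mathbb P_S\big[J_\tau(S)>\theta(\tau)\big]\le\delta,$$ and, for every fixed $x\in\mathbb R^d$, $$\mathbb P_S\big[\widehat s^{(S)}_\tau(x)\ne s_{U,\tau}(x)\big]\le\delta.$$ -/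

import Mathlib

open MeasureTheory ProbabilityTheory
open scoped ENNReal Gradient

noncomputable section

namespace HardFamily

/-- `ℝ^d` with `d = 2 m`, written as `m` planar blocks, with the Euclidean norm. -/
abbrev Space (m : ℕ) : Type := EuclideanSpace ℝ (Fin m × Fin 2)

/-- The dimension `d = 2 m`, as a real number. -/
def dim (m : ℕ) : ℝ := 2 * (m : ℝ)

/-! ### The product-circle support -/

/-- Number of points per circle, `M = ⌈π R / γ⌉`. -/
def numPoints (R γ : ℝ) : ℕ := ⌈Real.pi * (R / γ)⌉₊

/-- The point `a_k = R (cos (2πk/M), sin (2πk/M))` of the planar circle of radius `R`. -/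
def circlePoint (R γ : ℝ) (k : Fin (numPoints R γ)) : Fin 2 → ℝ :=
  ![R * Real.cos (2 * Real.pi * (k : ℝ) / (numPoints R γ : ℝ)),
    R * Real.sin (2 * Real.pi * (k : ℝ) / (numPoints R γ : ℝ))]

/-- The point of `ℝ^d` whose `j`-th planar block is `a_{k j}`. -/
def codeword (R γ : ℝ) (m : ℕ) (k : Fin m → Fin (numPoints R γ)) : Space m :=
  WithLp.toLp 2 (fun p => circlePoint R γ (k p.1) p.2)

/-- The support `𝒱 = {a_0, …, a_{M-1}}^{d/2}`. -/
def support (R γ : ℝ) (m : ℕ) : Set (Space m) := Set.range (codeword R γ m)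

/-- The uniform law `U` on `𝒱`. -/
def nullLaw (R γ : ℝ) (m : ℕ) : Measure (Space m) := uniformOn (support R γ m)

/-- The law of an i.i.d. codebook `S = (Y⁽¹⁾, …, Y⁽ⁿ⁾)` drawn from `U`. -/
def codebookLaw (R γ : ℝ) (m n : ℕ) : Measure (Fin n → Space m) :=
  Measure.pi (fun _ => nullLaw R γ m)

/-- The empirical measure `ν_S` of a codebook. -/
def empirical {m n : ℕ} (S : Fin n → Space m) : Measure (Space m) :=
  (n : ℝ≥0∞)⁻¹ • ∑ i, Measure.dirac (S i)

/-- The rate `κ(n) = (log n) / d`. -/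
def rate (m n : ℕ) : ℝ := Real.log n / dim m

/-! ### Gaussian smoothing and scores -/

/-- The density `φ_{τ²}` of `N(0, τ² I_d)`. -/
def gaussianDensity {m : ℕ} (τ : ℝ) (x : Space m) : ℝ :=
  ((2 * Real.pi * τ ^ 2) ^ m)⁻¹ * Real.exp (-‖x‖ ^ 2 / (2 * τ ^ 2))

/-- The Gaussian law `N(0, τ² I_d)`. -/
def gaussianNoise (m : ℕ) (τ : ℝ) : Measure (Space m) :=
  (volume : Measure (Space m)).withDensity (fun x => ENNReal.ofReal (gaussianDensity τ x))

/-- The smoothed law `μ * N(0, τ² I_d)`. -/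
def smoothed {m : ℕ} (μ : Measure (Space m)) (τ : ℝ) : Measure (Space m) :=
  Measure.conv μ (gaussianNoise m τ)

/-- The Lebesgue density `x ↦ ∫ φ_{τ²}(x - y) μ(dy)` of `μ * N(0, τ² I_d)`. -/
def smoothedDensity {m : ℕ} (μ : Measure (Space m)) (τ : ℝ) (x : Space m) : ℝ :=
  ∫ y, gaussianDensity τ (x - y) ∂μ

/-- The score of `μ * N(0, τ² I_d)`: the gradient of its log-density. -/
def score {m : ℕ} (μ : Measure (Space m)) (τ : ℝ) (x : Space m) : Space m :=
  gradient (fun z => Real.log (smoothedDensity μ τ z)) x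

/-! ### Likelihood ratios, information rate, Fisher term -/

/-- `L_τ(y, x) = φ_{τ²}(x - y) / u_τ(x)`. -/
def likelihoodRatio (R γ : ℝ) {m : ℕ} (τ : ℝ) (y x : Space m) : ℝ :=
  gaussianDensity τ (x - y) / smoothedDensity (nullLaw R γ m) τ x

/-- `ℓ_τ(y, x) = log L_τ(y, x)`. -/
def logRatio (R γ : ℝ) {m : ℕ} (τ : ℝ) (y x : Space m) : ℝ :=
  Real.log (likelihoodRatio R γ τ y x)

/-- The joint law of independent `Y ∼ U` and `Z ∼ N(0, τ² I_d)`. -/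
def signalNoise (R γ : ℝ) (m : ℕ) (τ : ℝ) : Measure (Space m × Space m) :=
  (nullLaw R γ m).prod (gaussianNoise m τ)

/-- `I_τ = (1/d) 𝔼[ℓ_τ(Y, Y + Z)]`. -/
def infoRate (R γ : ℝ) (m : ℕ) (τ : ℝ) : ℝ :=
  (∫ p, logRatio R γ τ p.1 (p.1 + p.2) ∂(signalNoise R γ m τ)) / dim m

/-- `J_τ(S) = 𝔼_{X ∼ ν_{S,τ}} ‖s_{S,τ}(X) - s_{U,τ}(X)‖²`. -/
def fisherTerm (R γ : ℝ) {m n : ℕ} (τ : ℝ) (S : Fin n → Space m) : ℝ :=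
  ∫ x, ‖score (empirical S) τ x - score (nullLaw R γ m) τ x‖ ^ 2 ∂(smoothed (empirical S) τ)

/-- `Λ_τ(ζ) = inf {l > 0 : ℙ[ℓ_τ(Y, Y + Z) ≤ log l] ≥ ζ}`. -/
def quantileLevel (R γ : ℝ) (m : ℕ) (τ ζ : ℝ) : ℝ :=
  sInf {l : ℝ | 0 < l ∧
    ζ ≤ (signalNoise R γ m τ).real {p | logRatio R γ τ p.1 (p.1 + p.2) ≤ Real.log l}}

/-! ### The oracle -/

/-- The cutoff `ψ`: `0` on `(-∞, 0]`, `1` on `[1, ∞)`, linear in between. -/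
def cutoff (t : ℝ) : ℝ := max 0 (min 1 t)

/-- `ℓ^max_{τ,S}(x) = max_{y ∈ S} ℓ_τ(y, x)`. -/
def maxLogRatio (R γ : ℝ) {m n : ℕ} (τ : ℝ) (S : Fin n → Space m) (x : Space m) : ℝ :=
  ⨆ i, logRatio R γ τ (S i) x

/-- The gate `m_{τ,S}(x) = ψ(ℓ^max_{τ,S}(x) - log Λ_τ(ζ) + 1)`. -/
def gate (R γ : ℝ) {m n : ℕ} (τ ζ : ℝ) (S : Fin n → Space m) (x : Space m) : ℝ :=
  cutoff (maxLogRatio R γ τ S x - Real.log (quantileLevel R γ m τ ζ) + 1)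

open Classical in
/-- The oracle response at total noise `τ`, for auxiliary functions `ζ` and `θ`. -/
def oracle (R γ : ℝ) (ζ θ : ℝ → ℝ) {m n : ℕ} (τ : ℝ) (S : Fin n → Space m) (x : Space m) :
    Space m :=
  if fisherTerm R γ τ S ≤ θ τ then score (nullLaw R γ m) τ x
  else score (nullLaw R γ m) τ x +
    gate R γ τ (ζ τ) S x • (score (empirical S) τ x - score (nullLaw R γ m) τ x)

/-! ### The upper rate threshold -/

/-- `δ = ρ² / (80 Q)`. -/
def failureProb (ρ : ℝ) (Q : ℕ) : ℝ := ρ ^ 2 / (80 * (Q : ℝ))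

/-- `H(τ) = max {1, log ((log (1 + |𝒱|) / δ) · C R² d² / (γ² τ² θ(τ)))}`. -/
def logFactor (C R γ : ℝ) (m : ℕ) (δ : ℝ) (θ : ℝ → ℝ) (τ : ℝ) : ℝ :=
  max 1 (Real.log (Real.log (1 + ((support R γ m).ncard : ℝ)) / δ *
    (C * R ^ 2 * dim m ^ 2 / (γ ^ 2 * τ ^ 2 * θ τ))))

/-- `τ̃ = √α τ` with `α = 1 - γ² / (R² d²)`. -/
def reducedNoise (R γ : ℝ) (m : ℕ) (τ : ℝ) : ℝ :=
  Real.sqrt (1 - γ ^ 2 / (R ^ 2 * dim m ^ 2)) * τ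

/-- `E_med(τ) = C √(d H(τ)) + C H(τ)`. -/
def errMed (C R γ : ℝ) (m : ℕ) (δ : ℝ) (θ : ℝ → ℝ) (τ : ℝ) : ℝ :=
  C * Real.sqrt (dim m * logFactor C R γ m δ θ τ) + C * logFactor C R γ m δ θ τ

/-- `E_big(τ) = C (R / τ̃) √(d H(τ)) + C H(τ)`. -/
def errBig (C R γ : ℝ) (m : ℕ) (δ : ℝ) (θ : ℝ → ℝ) (τ : ℝ) : ℝ :=
  C * (R / reducedNoise R γ m τ) * Real.sqrt (dim m * logFactor C R γ m δ θ τ) +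
    C * logFactor C R γ m δ θ τ

/-- `κ₊(τ) = I_{τ̃} + min {E_med(τ), E_big(τ)} / d`. -/
def upperRate (C R γ : ℝ) (m : ℕ) (δ : ℝ) (θ : ℝ → ℝ) (τ : ℝ) : ℝ :=
  infoRate R γ m (reducedNoise R γ m τ) +
    min (errMed C R γ m δ θ τ) (errBig C R γ m δ θ τ) / dim m

end HardFamily

end

/-! The plan is to bound the expectation of `J_τ(S)` over the codebook and apply Markov's
inequality. The claim about the oracle then follows at once, since it returns the null score
whenever `J_τ(S) ≤ θ(τ)`.

Fix `x`. By Tweedie's formula a score difference is `τ⁻²` times a difference of posterior means. Put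
`L(y) = φ(x - y) / u(x)`, which has mean one under `U`, and `V(y) = y - c`, where `c` is the null
posterior mean, so that `L V` has mean zero. The integrand of `J_τ(S)` becomes `u(x) τ⁻⁴ ‖avg_S (L
V)‖² / avg_S L`. This self-normalized average has no usable second moment when `L` is heavy-tailed,
so `L` is truncated at a level `λ`. The cost is `λ / n` from the variance and `𝔼[L; L > λ]` from the
discarded part (`avg_self_normalized_le`). Integrated over `x`, the latter is exactly `ℙ[ℓ_τ > log
λ]`, which gives `codebookLaw_fisherTerm_gt_le`.

It remains to bound the upper tail of `ℓ_τ`. Support and noise are products over the `m = d / 2`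
planar blocks, so `ℓ_τ` is a sum of i.i.d. block terms. Each lies within `min(1, R/τ) (|g|² + 6)` of
a constant, `g` being the standardized block noise (`exists_abs_blockLogRatio_sub_le`). For `τ ≤ R`
this holds because the Gaussian kernel averaged over the circle is of order `τ / R`; for `τ ≥ R`
because the term is Lipschitz in `1/τ` and vanishes at `1/τ = 0`. A Chernoff bound gives deviations
of order `min(1, R/τ) √(dH) + H` with failure probability at most `exp(-H)`, and `H` is designed so
that `exp(-H)` beats the prefactor of Markov's bound. Passing from `τ` to `τ̃` in the mean costs a
bounded amount, absorbed by `C H`. -/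

noncomputable section

namespace HardFamily

/-! ### Uniform measures on finite families of points -/

section UniformFamily

variable {ι E : Type*} [Fintype ι] [MeasurableSpace E]

/-- The uniform law on the finite family of points `y`. -/
def familyLaw (y : ι → E) : Measure E :=
  (Fintype.card ι : ℝ≥0∞)⁻¹ • ∑ i, Measure.dirac (y i)

/-- The average of a function over a finite type. -/
def avg {F : Type*} [AddCommGroup F] [Module ℝ F] (f : ι → F) : F :=
  (Fintype.card ι : ℝ)⁻¹ • ∑ i, f i

/-- Since this holds for every set, events about the Fisher term need no measurability proof. -/
theorem familyLaw_apply [MeasurableSingletonClass E] (y : ι → E) (A : Set E) :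
    familyLaw y A = (Fintype.card ι : ℝ≥0∞)⁻¹ * ∑ i, A.indicator 1 (y i) := by
  simp [familyLaw]

instance [Nonempty ι] (y : ι → E) : IsProbabilityMeasure (familyLaw y) := by
  constructor
  simp only [familyLaw, Measure.smul_apply, Measure.coe_finsetSum, Finset.sum_apply,
    measure_univ, Finset.sum_const, Finset.card_univ, smul_eq_mul, nsmul_eq_mul, mul_one]
  exact ENNReal.inv_mul_cancel (by simp) (by simp)

theorem integral_familyLaw [MeasurableSingletonClass E] {F : Type*} [NormedAddCommGroup F]
    [NormedSpace ℝ F] [CompleteSpace F] (y : ι → E) (f : E → F) :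
    ∫ x, f x ∂(familyLaw y) = avg (fun i => f (y i)) := by
  rw [familyLaw, integral_smul_measure, integral_finsetSum_measure]
  · simp [avg]
  · exact fun i _ => integrable_dirac (by simp)

theorem map_familyLaw {G : Type*} [MeasurableSpace G] (y : ι → E) {g : E → G}
    (hg : Measurable g) : (familyLaw y).map g = familyLaw (fun i => g (y i)) := by
  rw [familyLaw, familyLaw, Measure.map_smul]
  congr 1
  rw [← Measure.mapₗ_apply_of_measurable hg, map_sum]
  refine Finset.sum_congr rfl fun i _ => ?_
  rw [Measure.mapₗ_apply_of_measurable hg, Measure.map_dirac' hg]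

theorem uniformOn_range [MeasurableSingletonClass E] [Nonempty ι] {y : ι → E}
    (hy : Function.Injective y) : uniformOn (Set.range y) = familyLaw y := by
  classical
  have hs : (Set.range y).Finite := Set.finite_range y
  have hcard : Measure.count (Set.range y) = (Fintype.card ι : ℝ≥0∞) := by
    rw [Measure.count_apply hs.measurableSet, ← Set.image_univ, hy.injOn.encard_image]
    simp
  refine Measure.ext fun A hA => ?_
  rw [familyLaw_apply, uniformOn, cond_apply hs.measurableSet, hcard]
  congr 1
  have hfin : (Set.range y ∩ A).Finite := hs.inter_of_left A
  rw [Measure.count_apply hfin.measurableSet]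
  have : Set.range y ∩ A = y '' {i | y i ∈ A} := by
    ext x; constructor
    · rintro ⟨⟨i, rfl⟩, h⟩; exact ⟨i, h, rfl⟩
    · rintro ⟨i, h, rfl⟩; exact ⟨⟨i, rfl⟩, h⟩
  rw [this, hy.injOn.encard_image, Set.encard_eq_coe_toFinset_card]
  simp [Set.indicator_apply]

/-- Turns i.i.d. sampling into an average over index tuples. It serves twice: for the codebook, and
for the planar blocks of a single codeword. -/
theorem pi_familyLaw {κ : Type*} [Fintype κ] [Nonempty ι] [DecidableEq κ]
    [MeasurableSingletonClass E] (y : ι → E) :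
    Measure.pi (fun _ : κ => familyLaw y) =
      familyLaw (fun (k : κ → ι) (j : κ) => y (k j)) := by
  refine Measure.pi_eq fun s hs => ?_
  simp only [familyLaw_apply]
  rw [Finset.prod_mul_distrib, Finset.prod_univ_sum]
  simp only [Finset.prod_const, Finset.card_univ, Fintype.card_fun, Fintype.piFinset_univ]
  congr 1
  · push_cast
    rw [ENNReal.inv_pow]
  · refine Finset.sum_congr rfl fun k _ => ?_
    by_cases h : ∀ j, y (k j) ∈ s j
    · rw [Set.indicator_of_mem (by simpa [Set.mem_pi] using h)]
      simp [Set.indicator_of_mem (h _)]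
    · have h' : (fun j => y (k j)) ∉ Set.univ.pi s := by simpa [Set.mem_pi] using h
      rw [Set.indicator_of_notMem h']
      push Not at h
      obtain ⟨j, hj⟩ := h
      exact (Finset.prod_eq_zero (Finset.mem_univ j) (Set.indicator_of_notMem hj _)).symm

theorem avg_mono {f g : ι → ℝ} (h : ∀ i, f i ≤ g i) : avg f ≤ avg g := by
  simp only [avg, smul_eq_mul]
  gcongr with i; exact h i

theorem avg_nonneg {f : ι → ℝ} (h : ∀ i, 0 ≤ f i) : 0 ≤ avg f := by
  simp only [avg, smul_eq_mul]
  exact mul_nonneg (by positivity) (Finset.sum_nonneg fun i _ => h i)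

theorem avg_pos [Nonempty ι] {f : ι → ℝ} (h : ∀ i, 0 < f i) : 0 < avg f := by
  simp only [avg, smul_eq_mul]
  exact mul_pos (by positivity) (Finset.sum_pos (fun i _ => h i) Finset.univ_nonempty)

theorem avg_const [Nonempty ι] {F : Type*} [AddCommGroup F] [Module ℝ F] (c : F) :
    avg (fun _ : ι => c) = c := by
  have : (Fintype.card ι : ℝ) ≠ 0 := by simp
  simp [avg, ← Nat.cast_smul_eq_nsmul ℝ, smul_smul, this]

theorem avg_add {F : Type*} [AddCommGroup F] [Module ℝ F] (f g : ι → F) :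
    avg (fun i => f i + g i) = avg f + avg g := by
  simp [avg, Finset.sum_add_distrib]

theorem avg_sub {F : Type*} [AddCommGroup F] [Module ℝ F] (f g : ι → F) :
    avg (fun i => f i - g i) = avg f - avg g := by
  simp [avg, Finset.sum_sub_distrib, smul_sub]

theorem avg_mul_left (c : ℝ) (f : ι → ℝ) : avg (fun i => c * f i) = c * avg f := by
  simp only [avg, smul_eq_mul, ← Finset.mul_sum]; ring

theorem avg_div (c : ℝ) (f : ι → ℝ) : avg (fun i => f i / c) = avg f / c := by
  simp only [avg, smul_eq_mul, ← Finset.sum_div]; ring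

theorem norm_avg_le {F : Type*} [NormedAddCommGroup F] [NormedSpace ℝ F] (f : ι → F) :
    ‖avg f‖ ≤ avg (fun i => ‖f i‖) := by
  simp only [avg, norm_smul, smul_eq_mul, norm_inv, RCLike.norm_natCast]
  gcongr
  exact norm_sum_le _ _

end UniformFamily

/-! ### Second moments of averages over i.i.d. samples -/

section SecondMoment

variable {ι : Type*} [Fintype ι]

theorem avg_fin_succ {F : Type*} [AddCommGroup F] [Module ℝ F] (n : ℕ)
    (f : (Fin (n + 1) → ι) → F) :
    avg f = avg (fun a : ι => avg (fun k : Fin n → ι => f (Fin.cons a k))) := by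
  simp only [avg, Fintype.card_fun, Fintype.card_fin, ← Finset.smul_sum, smul_smul]
  rw [← (Fin.consEquiv (fun _ => ι)).sum_comp, Fintype.sum_prod_type]
  congr 1
  push_cast
  rw [pow_succ, mul_inv, mul_comm]

theorem avg_fin_zero {F : Type*} [AddCommGroup F] [Module ℝ F] (f : (Fin 0 → ι) → F) :
    avg f = f ![] := by
  have : ∀ k : Fin 0 → ι, k = ![] := fun k => Subsingleton.elim _ _
  simp [avg, this]

theorem avg_sum_sample {F : Type*} [AddCommGroup F] [Module ℝ F] [Nonempty ι] (W : ι → F)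
    (n : ℕ) : avg (fun k : Fin n → ι => ∑ j, W (k j)) = (n : ℝ) • avg W := by
  induction n with
  | zero => rw [avg_fin_zero]; simp
  | succ n ih =>
    rw [avg_fin_succ]
    simp only [Fin.sum_univ_succ, Fin.cons_zero, Fin.cons_succ, avg_add, avg_const, ih]
    push_cast
    rw [add_smul, one_smul, add_comm]

theorem avg_sample {F : Type*} [AddCommGroup F] [Module ℝ F] [Nonempty ι] (W : ι → F)
    {n : ℕ} (hn : 1 ≤ n) : avg (fun k : Fin n → ι => avg (fun j => W (k j))) = avg W := by
  have h := avg_sum_sample W n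
  have hn' : (n : ℝ) ≠ 0 := by positivity
  have h2 : avg (fun k : Fin n → ι => avg (fun j => W (k j))) =
      (n : ℝ)⁻¹ • avg (fun k : Fin n → ι => ∑ j, W (k j)) := by
    simp only [avg, Fintype.card_fin, ← Finset.smul_sum]
    rw [smul_comm]
  rw [h2, h, smul_smul, inv_mul_cancel₀ hn', one_smul]

variable {F : Type*} [NormedAddCommGroup F] [InnerProductSpace ℝ F]

/-- Independence: the `n` diagonal terms give second moments, and each of the `n (n - 1)`
off-diagonal terms gives `‖avg W‖²`. The induction splits off the first sample. -/
theorem avg_norm_sq_sum_sample [Nonempty ι] (W : ι → F) (n : ℕ) :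
    avg (fun k : Fin n → ι => ‖∑ j, W (k j)‖ ^ 2) =
      n * avg (fun i => ‖W i‖ ^ 2) + n * (n - 1) * ‖avg W‖ ^ 2 := by
  induction n with
  | zero => rw [avg_fin_zero]; simp
  | succ n ih =>
    have key : ∀ a : ι, avg (fun k : Fin n → ι => inner ℝ (W a) (∑ j, W (k j))) =
        inner ℝ (W a) ((n : ℝ) • avg W) := fun a => by
      rw [← avg_sum_sample W n]
      simp only [avg, inner_smul_right, inner_sum, smul_eq_mul]
    have key2 : avg (fun a : ι => inner ℝ (W a) ((n : ℝ) • avg W)) = n * ‖avg W‖ ^ 2 := by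
      rw [← real_inner_self_eq_norm_sq, ← inner_smul_right]
      conv_rhs => rw [avg, inner_smul_left, sum_inner]
      simp [avg]
    rw [avg_fin_succ]
    simp only [Fin.sum_univ_succ, Fin.cons_zero, Fin.cons_succ, norm_add_sq_real, avg_add,
      avg_const, avg_mul_left, ih, key, key2]
    push_cast
    ring

theorem avg_norm_sq_sample_le [Nonempty ι] (W : ι → F) {n : ℕ} (hn : 1 ≤ n) :
    avg (fun k : Fin n → ι => ‖avg (fun j => W (k j))‖ ^ 2) ≤
      avg (fun i => ‖W i‖ ^ 2) / n + ‖avg W‖ ^ 2 := by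
  have hn' : (0 : ℝ) < n := by positivity
  have h : ∀ k : Fin n → ι, ‖avg (fun j => W (k j))‖ ^ 2 =
      ‖∑ j, W (k j)‖ ^ 2 / (n : ℝ) ^ 2 := fun k => by
    simp [avg, norm_smul, mul_pow, div_eq_inv_mul]
  simp only [h, avg_div, avg_norm_sq_sum_sample]
  rw [div_add' _ _ _ hn'.ne', div_le_div_iff₀ (by positivity) hn']
  nlinarith [sq_nonneg ‖avg W‖, mul_pos hn' hn',
    mul_nonneg (mul_pos hn' hn').le (sq_nonneg ‖avg W‖)]

/-- Truncated second-moment bound for self-normalized averages of an i.i.d. sample. -/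
theorem avg_self_normalized_le [Nonempty ι] {L : ι → ℝ} {V : ι → F} {D lam : ℝ} {n : ℕ}
    (hn : 1 ≤ n) (hL : ∀ i, 0 < L i) (hL1 : avg L = 1) (hV : ∀ i, ‖V i‖ ≤ D)
    (hLV : avg (fun i => L i • V i) = 0) (hlam : 0 < lam) :
    avg (fun k : Fin n → ι =>
        ‖avg (fun j => L (k j) • V (k j))‖ ^ 2 / avg (fun j => L (k j))) ≤
      8 * D ^ 2 * (lam / n + avg (fun i => if lam < L i then L i else 0)) := by
  have hn' : (0 : ℝ) < n := by positivity
  have : Nonempty (Fin n) := ⟨⟨0, hn⟩⟩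
  obtain ⟨i₀⟩ := ‹Nonempty ι›
  have : Nonempty ι := ⟨i₀⟩
  have hD : 0 ≤ D := (norm_nonneg _).trans (hV i₀)
  -- `L₁` is the part of `L` at or below the truncation level, with second moment at most `lam`;
  -- `L₂` is the rest, with mean `ε`.
  set L₂ : ι → ℝ := fun i => if lam < L i then L i else 0 with hL₂
  set L₁ : ι → ℝ := fun i => L i - L₂ i with hL₁
  have hL₂0 : ∀ i, 0 ≤ L₂ i := fun i => by
    simp only [hL₂]; split_ifs; exacts [(hL i).le, le_rfl]
  have hL₁0 : ∀ i, 0 ≤ L₁ i := fun i => by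
    simp only [hL₁, hL₂]; split_ifs; exacts [by simp, by simpa using (hL i).le]
  have hL₁lam : ∀ i, L₁ i ≤ lam := fun i => by
    simp only [hL₁, hL₂]; split_ifs with h; exacts [by simpa using hlam.le, by simpa using h]
  set ε := avg L₂ with hε
  have hε0 : 0 ≤ ε := avg_nonneg hL₂0
  have hμ : avg L₁ = 1 - ε := by rw [hL₁, avg_sub, hL1]
  have hε1 : ε ≤ 1 := by
    have := avg_nonneg hL₁0
    linarith
  have hsq : avg (fun i => L₁ i ^ 2) ≤ lam := by
    calc avg (fun i => L₁ i ^ 2) ≤ avg (fun i => lam * L₁ i) :=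
          avg_mono fun i => by nlinarith [hL₁0 i, hL₁lam i]
      _ = lam * (1 - ε) := by rw [avg_mul_left, hμ]
      _ ≤ lam := by nlinarith
  -- Variance at most `lam / n`, plus squared bias `ε² ≤ ε`.
  have hr1 : avg (fun k : Fin n → ι => (avg (fun j => L₁ (k j)) - 1) ^ 2) ≤ lam / n + ε := by
    have h1 := avg_norm_sq_sample_le L₁ hn
    simp only [Real.norm_eq_abs, sq_abs, hμ] at h1
    have h2 : ∀ k : Fin n → ι, (avg (fun j => L₁ (k j)) - 1) ^ 2 =
        avg (fun j => L₁ (k j)) ^ 2 - 2 * avg (fun j => L₁ (k j)) + 1 := fun k => by ring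
    simp only [h2, avg_add, avg_sub, avg_const, avg_mul_left, avg_sample L₁ hn, hμ]
    have h3 : avg (fun i => L₁ i ^ 2) / n ≤ lam / n := by gcongr
    nlinarith
  have hA1 : avg (fun k : Fin n → ι => ‖avg (fun j => L₁ (k j) • V (k j))‖ ^ 2) ≤
      D ^ 2 * (lam / n + ε) := by
    refine (avg_norm_sq_sample_le (fun i => L₁ i • V i) hn).trans ?_
    have h1 : avg (fun i => ‖L₁ i • V i‖ ^ 2) ≤ D ^ 2 * lam := by
      calc avg (fun i => ‖L₁ i • V i‖ ^ 2) ≤ avg (fun i => D ^ 2 * L₁ i ^ 2) :=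
            avg_mono fun i => by
              rw [norm_smul, mul_pow, Real.norm_eq_abs, sq_abs, mul_comm]
              gcongr; exact hV i
        _ ≤ D ^ 2 * lam := by rw [avg_mul_left]; gcongr
    have h2 : ‖avg (fun i => L₁ i • V i)‖ ≤ D * ε := by
      -- Since `L V` is centred, the bias of the truncated part is minus that of the tail, hence at
      -- most `D ε`.
      have : avg (fun i => L₁ i • V i) = - avg (fun i => L₂ i • V i) := by
        simp only [hL₁, sub_smul, avg_sub, hLV, zero_sub]
      rw [this, norm_neg, hε, ← avg_mul_left]
      refine (norm_avg_le _).trans (avg_mono fun i => ?_)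
      rw [norm_smul, Real.norm_of_nonneg (hL₂0 i), mul_comm]
      exact mul_le_mul_of_nonneg_right (hV i) (hL₂0 i)
    have h3 : ‖avg (fun i => L₁ i • V i)‖ ^ 2 ≤ D ^ 2 * ε := by
      calc _ ≤ (D * ε) ^ 2 := by gcongr
        _ ≤ D ^ 2 * ε := by
          rw [mul_pow]; gcongr; nlinarith
    have h4 : avg (fun i => ‖L₁ i • V i‖ ^ 2) / n ≤ D ^ 2 * lam / n := by gcongr
    calc _ ≤ D ^ 2 * lam / n + D ^ 2 * ε := add_le_add h4 h3
      _ = _ := by ring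
  have hpt : ∀ k : Fin n → ι,
      ‖avg (fun j => L (k j) • V (k j))‖ ^ 2 / avg (fun j => L (k j)) ≤
        4 * ‖avg (fun j => L₁ (k j) • V (k j))‖ ^ 2 + 2 * D ^ 2 * avg (fun j => L₂ (k j)) +
          2 * D ^ 2 * (avg (fun j => L₁ (k j)) - 1) ^ 2 := fun k => by
    have hr : 0 < avg (fun j => L (k j)) := avg_pos fun j => hL _
    have hr2 : 0 ≤ avg (fun j => L₂ (k j)) := avg_nonneg fun j => hL₂0 _
    have hr1 : 0 ≤ avg (fun j => L₁ (k j)) := avg_nonneg fun j => hL₁0 _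
    have hrr : avg (fun j => L (k j)) = avg (fun j => L₁ (k j)) + avg (fun j => L₂ (k j)) := by
      rw [← avg_add]; simp [hL₁]
    have hAA : avg (fun j => L (k j) • V (k j)) =
        avg (fun j => L₁ (k j) • V (k j)) + avg (fun j => L₂ (k j) • V (k j)) := by
      rw [← avg_add]; simp [hL₁, ← add_smul]
    have hbd : ∀ M : ι → ℝ, (∀ i, 0 ≤ M i) →
        ‖avg (fun j => M (k j) • V (k j))‖ ≤ D * avg (fun j => M (k j)) := fun M hM => by
      rw [← avg_mul_left]
      refine (norm_avg_le _).trans (avg_mono fun i => ?_)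
      rw [norm_smul, Real.norm_of_nonneg (hM _), mul_comm]
      exact mul_le_mul_of_nonneg_right (hV _) (hM _)
    have hA := hbd L fun i => (hL i).le
    have hA2 := hbd L₂ hL₂0
    rw [div_le_iff₀ hr]
    set A := avg (fun j => L (k j) • V (k j))
    set A₁ := avg (fun j => L₁ (k j) • V (k j))
    set A₂ := avg (fun j => L₂ (k j) • V (k j))
    set r := avg (fun j => L (k j))
    set r₁ := avg (fun j => L₁ (k j))
    set r₂ := avg (fun j => L₂ (k j))
    -- If the normalizer `r` is at least `1/2`, the truncated part is divided by it at the cost of a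
    -- factor 2. Otherwise `r₁ ≤ r < 1/2`, so `(r₁ - 1)² ≥ 1/4` and the trivial bound `D² r` is paid
    -- for by the fluctuation of `r₁`.
    rcases le_or_gt (1 / 2) r with h | h
    · have h1 : ‖A‖ ^ 2 ≤ 2 * ‖A₁‖ ^ 2 + 2 * ‖A₂‖ ^ 2 := by
        have := norm_add_le A₁ A₂
        rw [← hAA] at this
        nlinarith [sq_nonneg (‖A₁‖ - ‖A₂‖), norm_nonneg A]
      have h2 : ‖A₂‖ ^ 2 ≤ D ^ 2 * r₂ * r := by
        calc ‖A₂‖ ^ 2 ≤ (D * r₂) ^ 2 := by gcongr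
          _ = D ^ 2 * r₂ * r₂ := by ring
          _ ≤ D ^ 2 * r₂ * r := by gcongr; linarith
      have h3 : 2 * ‖A₁‖ ^ 2 ≤ 4 * ‖A₁‖ ^ 2 * r := by nlinarith [sq_nonneg ‖A₁‖]
      have h4 : 0 ≤ 2 * D ^ 2 * (r₁ - 1) ^ 2 * r := by positivity
      linarith
    · have h1 : ‖A‖ ^ 2 ≤ D ^ 2 * r * r := by
        calc ‖A‖ ^ 2 ≤ (D * r) ^ 2 := by gcongr
          _ = _ := by ring
      have h2 : r ≤ 2 * (r₁ - 1) ^ 2 := by nlinarith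
      have h3 : D ^ 2 * r * r ≤ 2 * D ^ 2 * (r₁ - 1) ^ 2 * r := by
        calc D ^ 2 * r * r ≤ D ^ 2 * (2 * (r₁ - 1) ^ 2) * r := by gcongr
          _ = _ := by ring
      have h4 : 0 ≤ 4 * ‖A₁‖ ^ 2 * r := by positivity
      have h5 : 0 ≤ 2 * D ^ 2 * r₂ * r := by positivity
      linarith
  refine (avg_mono hpt).trans ?_
  simp only [avg_add, avg_mul_left, avg_sample L₂ hn]
  have h0 : 0 ≤ lam / n := by positivity
  nlinarith [mul_le_mul_of_nonneg_left hr1 (by positivity : 0 ≤ 2 * D ^ 2), sq_nonneg D,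
    mul_nonneg (sq_nonneg D) h0, mul_nonneg (sq_nonneg D) hε0]

end SecondMoment

/-! ### The codebook -/

theorem numPoints_ge (R γ : ℝ) : Real.pi * (R / γ) ≤ numPoints R γ := Nat.le_ceil _

theorem numPoints_pos {R γ : ℝ} (hR : 0 < R) (hγ : 0 < γ) : 0 < numPoints R γ :=
  Nat.ceil_pos.2 (by positivity)

/-- The points are `R` times the powers of a primitive `M`-th root of unity. -/
theorem circlePoint_injective {R γ : ℝ} (hR : 0 < R) (hγ : 0 < γ) :
    Function.Injective (circlePoint R γ) := by
  have hM := numPoints_pos hR hγ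
  intro a b hab
  have h0 := congrFun hab 0
  have h1 := congrFun hab 1
  simp only [circlePoint, Matrix.cons_val_zero, Matrix.cons_val_one, mul_eq_mul_left_iff,
    hR.ne', or_false] at h0 h1
  have hprim := Complex.isPrimitiveRoot_exp (numPoints R γ) hM.ne'
  have hpow : ∀ k : ℕ, Complex.exp (2 * Real.pi * Complex.I / (numPoints R γ : ℝ)) ^ k =
      Real.cos (2 * Real.pi * (k : ℝ) / (numPoints R γ : ℝ)) +
        Real.sin (2 * Real.pi * (k : ℝ) / (numPoints R γ : ℝ)) * Complex.I := fun k => by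
    rw [← Complex.exp_nat_mul, Complex.ofReal_cos, Complex.ofReal_sin, ← Complex.exp_mul_I]
    congr 1; push_cast; ring
  refine Fin.ext (hprim.pow_inj a.2 b.2 ?_)
  have key := (hpow a).trans ((by rw [h0, h1] : _ = _).trans (hpow b).symm)
  simpa using key

theorem codeword_injective {R γ : ℝ} (hR : 0 < R) (hγ : 0 < γ) (m : ℕ) :
    Function.Injective (codeword R γ m) := by
  intro k l hkl
  funext j
  refine circlePoint_injective hR hγ (funext fun b => ?_)
  simpa [codeword] using congrFun (congrArg WithLp.ofLp hkl) (j, b)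

theorem nonempty_fin_numPoints {R γ : ℝ} (hR : 0 < R) (hγ : 0 < γ) :
    Nonempty (Fin (numPoints R γ)) := ⟨⟨0, numPoints_pos hR hγ⟩⟩

theorem nullLaw_eq {R γ : ℝ} (hR : 0 < R) (hγ : 0 < γ) (m : ℕ) :
    nullLaw R γ m = familyLaw (codeword R γ m) := by
  have := nonempty_fin_numPoints hR hγ
  exact uniformOn_range (codeword_injective hR hγ m)

theorem codebookLaw_eq {R γ : ℝ} (hR : 0 < R) (hγ : 0 < γ) (m n : ℕ) :
    codebookLaw R γ m n = familyLaw
      (fun (k : Fin n → Fin m → Fin (numPoints R γ)) (j : Fin n) => codeword R γ m (k j)) := by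
  have := nonempty_fin_numPoints hR hγ
  rw [codebookLaw, nullLaw_eq hR hγ, pi_familyLaw]

theorem empirical_eq {m n : ℕ} (S : Fin n → Space m) : empirical S = familyLaw S := by
  simp [empirical, familyLaw]

theorem norm_codeword_sq {R γ : ℝ} (m : ℕ) (k : Fin m → Fin (numPoints R γ)) :
    ‖codeword R γ m k‖ ^ 2 = m * R ^ 2 := by
  rw [EuclideanSpace.norm_sq_eq, Fintype.sum_prod_type]
  have : ∀ j : Fin m, ∑ b : Fin 2, ‖codeword R γ m k (j, b)‖ ^ 2 = R ^ 2 := fun j => by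
    simp only [codeword, circlePoint, Fin.sum_univ_two, Real.norm_eq_abs, sq_abs,
      Matrix.cons_val_zero, Matrix.cons_val_one]
    linear_combination R ^ 2 * Real.cos_sq_add_sin_sq (2 * Real.pi * (k j : ℝ) / numPoints R γ)
  rw [Finset.sum_congr rfl fun j _ => this j]
  simp

/-! ### Gaussian densities and scores of finite mixtures -/

theorem gaussianDensity_pos {m : ℕ} {τ : ℝ} (hτ : 0 < τ) (x : Space m) :
    0 < gaussianDensity τ x := by
  unfold gaussianDensity; positivity

theorem continuous_gaussianDensity (m : ℕ) (τ : ℝ) :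
    Continuous (gaussianDensity (m := m) τ) := by
  unfold gaussianDensity; fun_prop

theorem integrable_gaussianDensity (m : ℕ) {τ : ℝ} (hτ : 0 < τ) :
    Integrable (gaussianDensity (m := m) τ) := by
  refine Integrable.const_mul ?_ _
  have hb : 0 < ((1 / (2 * τ ^ 2) : ℝ) : ℂ).re := by
    rw [Complex.ofReal_re]; positivity
  have h := (GaussianFourier.integrable_cexp_neg_mul_sq_norm_add hb 0 (0 : Space m)).norm
  refine h.congr (Filter.Eventually.of_forall fun v => ?_)
  simp only [Complex.norm_exp]
  congr 1
  simp only [zero_mul, add_zero, ← Complex.ofReal_pow, ← Complex.ofReal_neg,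
    ← Complex.ofReal_mul, Complex.ofReal_re]
  ring

theorem smoothedDensity_familyLaw {ι : Type*} [Fintype ι] {m : ℕ} (y : ι → Space m) (τ : ℝ)
    (x : Space m) :
    smoothedDensity (familyLaw y) τ x = avg (fun i => gaussianDensity τ (x - y i)) :=
  integral_familyLaw _ _

/-- The posterior mean `𝔼[Y | Y + Z = x]` for `Y` uniform on a finite family of points. -/
def posteriorMean {ι : Type*} [Fintype ι] {m : ℕ} (y : ι → Space m) (τ : ℝ) (x : Space m) :
    Space m :=
  (avg (fun i => gaussianDensity τ (x - y i)))⁻¹ •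
    avg (fun i => gaussianDensity τ (x - y i) • y i)

theorem hasFDerivAt_gaussianDensity_sub {m : ℕ} (τ : ℝ) (y x : Space m) :
    HasFDerivAt (fun z => gaussianDensity τ (z - y))
      ((gaussianDensity τ (x - y) * (τ ^ 2)⁻¹) • innerSL ℝ (y - x)) x := by
  have h1 : HasFDerivAt (fun z : Space m => z - y) (ContinuousLinearMap.id ℝ _) x :=
    (hasFDerivAt_id x).sub_const y
  have h2 := ((h1.norm_sq.neg.mul_const (2 * τ ^ 2)⁻¹).exp).const_mul
    (((2 * Real.pi * τ ^ 2) ^ m)⁻¹)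
  simp only [gaussianDensity, div_eq_mul_inv]
  refine h2.congr_fderiv ?_
  ext v
  simp only [smul_apply, smul_eq_mul, neg_apply,
    ContinuousLinearMap.comp_apply, ContinuousLinearMap.id_apply, innerSL_apply_apply,
    inner_sub_left, nsmul_eq_mul, mul_inv, Pi.neg_apply]
  push_cast
  ring

/-- Tweedie's formula. It makes score differences independent of the additive `x`, leaving only
posterior means. -/
theorem score_familyLaw {ι : Type*} [Fintype ι] [Nonempty ι] {m : ℕ} (y : ι → Space m) {τ : ℝ}
    (hτ : 0 < τ) (x : Space m) :
    score (familyLaw y) τ x = (τ ^ 2)⁻¹ • (posteriorMean y τ x - x) := by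
  have hp : 0 < avg (fun i => gaussianDensity τ (x - y i)) :=
    avg_pos fun i => gaussianDensity_pos hτ _
  have h1 : HasFDerivAt (fun z => avg (fun i => gaussianDensity τ (z - y i)))
      ((Fintype.card ι : ℝ)⁻¹ •
        ∑ i, (gaussianDensity τ (x - y i) * (τ ^ 2)⁻¹) • innerSL ℝ (y i - x)) x := by
    have h0 : HasFDerivAt (fun z => ∑ i, gaussianDensity τ (z - y i))
        (∑ i, (gaussianDensity τ (x - y i) * (τ ^ 2)⁻¹) • innerSL ℝ (y i - x)) x :=
      HasFDerivAt.fun_sum fun i _ => hasFDerivAt_gaussianDensity_sub τ (y i) x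
    exact h0.const_mul _
  have h2 := h1.log hp.ne'
  simp only [score, smoothedDensity_familyLaw]
  refine HasGradientAt.gradient ?_
  rw [hasGradientAt_iff_hasFDerivAt]
  refine h2.congr_fderiv ?_
  ext v
  simp only [posteriorMean, avg, smul_apply, sum_apply,
    InnerProductSpace.toDual_apply_apply, innerSL_apply_apply, inner_smul_left, inner_sub_left,
    sum_inner, smul_eq_mul, RCLike.conj_to_real] at hp ⊢
  have hc : (Fintype.card ι : ℝ)⁻¹ ≠ 0 := by simp
  have hs : ∑ i, gaussianDensity τ (x - y i) ≠ 0 := fun h => by simp [h] at hp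
  simp only [mul_sub, Finset.sum_sub_distrib, mul_assoc, mul_left_comm _ (τ ^ 2)⁻¹,
    ← Finset.mul_sum, ← Finset.sum_mul]
  field_simp

/-! ### The Gaussian noise as a product of planar blocks -/

/-- The standard Gaussian law on a planar block. -/
def planarGaussian : Measure (Fin 2 → ℝ) := Measure.pi fun _ => gaussianReal 0 1

instance : IsProbabilityMeasure planarGaussian := by
  unfold planarGaussian; infer_instance

/-- The noise vector with standardized planar blocks `g`. -/
def blockNoise {m : ℕ} (τ : ℝ) (g : Fin m → Fin 2 → ℝ) : Space m :=
  WithLp.toLp 2 (fun p => τ * g p.1 p.2)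

theorem measurable_blockNoise {m : ℕ} (τ : ℝ) : Measurable (blockNoise (m := m) τ) := by
  unfold blockNoise; fun_prop

/-- Finiteness is needed first, for uniqueness of characteristic functions; total mass one follows
later from the product representation. -/
instance isFiniteMeasure_gaussianNoise (m : ℕ) (τ : ℝ) [Fact (0 < τ)] :
    IsFiniteMeasure (gaussianNoise m τ) :=
  isFiniteMeasure_withDensity_ofReal (integrable_gaussianDensity m Fact.out).2

theorem charFun_gaussianNoise (m : ℕ) {τ : ℝ} (hτ : 0 < τ) (t : Space m) :
    charFun (gaussianNoise m τ) t = Complex.exp (-(τ ^ 2 * ‖t‖ ^ 2 / 2 : ℝ)) := by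
  have hb : 0 < ((1 / (2 * τ ^ 2) : ℝ) : ℂ).re := by
    rw [Complex.ofReal_re]; positivity
  have h := GaussianFourier.integral_cexp_neg_mul_sq_norm_add hb Complex.I t
  rw [charFun_apply, gaussianNoise, integral_withDensity_eq_integral_toReal_smul
    (continuous_gaussianDensity m τ).measurable.ennreal_ofReal (by simp)]
  have hτ' : (τ : ℂ) ≠ 0 := by exact_mod_cast hτ.ne'
  have h2 : ∀ x : Space m, (ENNReal.ofReal (gaussianDensity τ x)).toReal •
      Complex.exp ((inner ℝ x t : ℝ) * Complex.I) = (((2 * Real.pi * τ ^ 2) ^ m)⁻¹ : ℝ) *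
        Complex.exp (-((1 / (2 * τ ^ 2) : ℝ) : ℂ) * ‖x‖ ^ 2 + Complex.I * (inner ℝ t x : ℝ)) :=
    fun x => by
      rw [ENNReal.toReal_ofReal (gaussianDensity_pos hτ x).le, gaussianDensity, Complex.real_smul,
        Complex.ofReal_mul, Complex.ofReal_exp, mul_assoc, ← Complex.exp_add, real_inner_comm]
      congr 2
      push_cast
      ring
  simp only [h2]
  rw [integral_const_mul, h]
  have hpi : (Real.pi : ℂ) ≠ 0 := by exact_mod_cast Real.pi_ne_zero
  have hfin : ((Module.finrank ℝ (Space m) : ℂ) / 2) = (m : ℂ) := by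
    simp
  rw [hfin, Complex.cpow_natCast, ← mul_assoc]
  have h3 : ((((2 * Real.pi * τ ^ 2) ^ m)⁻¹ : ℝ) : ℂ) *
      ((Real.pi : ℂ) / ((1 / (2 * τ ^ 2) : ℝ) : ℂ)) ^ m = 1 := by
    have : (Real.pi : ℂ) / ((1 / (2 * τ ^ 2) : ℝ) : ℂ) = ((2 * Real.pi * τ ^ 2 : ℝ) : ℂ) := by
      push_cast; field_simp
    rw [this]
    push_cast
    exact inv_mul_cancel₀
      (pow_ne_zero _ (mul_ne_zero (mul_ne_zero two_ne_zero hpi) (pow_ne_zero _ hτ')))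
  rw [h3, one_mul]
  congr 1
  push_cast
  rw [Complex.I_sq]
  field_simp
  ring

/-- Both sides have characteristic function `exp(-τ² ‖t‖² / 2)`. The product form is what lets the
information density split over blocks. -/
theorem gaussianNoise_eq_map (m : ℕ) {τ : ℝ} (hτ : 0 < τ) :
    gaussianNoise m τ = (Measure.pi fun _ : Fin m => planarGaussian).map (blockNoise τ) := by
  have : Fact (0 < τ) := ⟨hτ⟩
  have hmap : IsProbabilityMeasure
      ((Measure.pi fun _ : Fin m => planarGaussian).map (blockNoise τ)) :=
    Measure.isProbabilityMeasure_map (measurable_blockNoise τ).aemeasurable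
  refine Measure.ext_of_charFun (funext fun t => ?_)
  rw [charFun_gaussianNoise m hτ, charFun_apply,
    integral_map (measurable_blockNoise τ).aemeasurable (by fun_prop)]
  have h1 : ∀ g : Fin m → Fin 2 → ℝ,
      Complex.exp ((inner ℝ (blockNoise τ g) t : ℝ) * Complex.I) =
        ∏ j, ∏ b, Complex.exp ((τ * t (j, b) : ℝ) * (g j b) * Complex.I) := fun g => by
    simp only [← Complex.exp_sum]
    congr 1
    rw [PiLp.inner_apply, Fintype.sum_prod_type]
    push_cast
    rw [Finset.sum_mul]
    refine Finset.sum_congr rfl fun j _ => ?_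
    rw [Finset.sum_mul]
    refine Finset.sum_congr rfl fun b _ => ?_
    simp [blockNoise]
    ring
  simp only [h1]
  rw [integral_fintype_prod_eq_prod (f := fun j (x : Fin 2 → ℝ) =>
    ∏ b, Complex.exp ((τ * t (j, b) : ℝ) * (x b) * Complex.I))]
  have h2 : ∀ j : Fin m, ∫ x : Fin 2 → ℝ, ∏ b, Complex.exp ((τ * t (j, b) : ℝ) * (x b) *
      Complex.I) ∂planarGaussian = ∏ b, Complex.exp (-((τ * t (j, b)) ^ 2 / 2 : ℝ)) := fun j => by
    rw [planarGaussian, integral_fintype_prod_eq_prod (f := fun b (x : ℝ) =>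
      Complex.exp ((τ * t (j, b) : ℝ) * x * Complex.I))]
    refine Finset.prod_congr rfl fun b _ => ?_
    rw [← charFun_apply_real, charFun_gaussianReal]
    congr 1
    push_cast
    ring
  rw [Finset.prod_congr rfl fun j _ => h2 j]
  simp only [← Complex.exp_sum]
  congr 1
  rw [EuclideanSpace.norm_sq_eq, Fintype.sum_prod_type]
  push_cast
  simp only [Finset.sum_neg_distrib, Finset.mul_sum, Finset.sum_div]
  congr 1
  refine Finset.sum_congr rfl fun j _ => Finset.sum_congr rfl fun b _ => ?_
  have h3 : ((|t (j, b)| : ℝ) : ℂ) ^ 2 = ((t (j, b) : ℝ) : ℂ) ^ 2 := by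
    exact_mod_cast congrArg Complex.ofReal (sq_abs (t (j, b)))
  rw [Real.norm_eq_abs, h3]
  push_cast
  ring

theorem isProbabilityMeasure_gaussianNoise (m : ℕ) {τ : ℝ} (hτ : 0 < τ) :
    IsProbabilityMeasure (gaussianNoise m τ) := by
  rw [gaussianNoise_eq_map m hτ]
  exact Measure.isProbabilityMeasure_map (measurable_blockNoise τ).aemeasurable

/-! ### The expected Fisher term of a random codebook -/

section Fisher

variable {m : ℕ} {ι : Type*} [Fintype ι]

@[fun_prop]
theorem measurable_gaussianDensity (m : ℕ) (τ : ℝ) : Measurable (gaussianDensity (m := m) τ) :=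
  (continuous_gaussianDensity m τ).measurable

theorem continuous_avg_gaussianDensity (y : ι → Space m) (τ : ℝ) :
    Continuous fun x => avg (fun i => gaussianDensity τ (x - y i)) := by
  simp only [avg]
  have := continuous_gaussianDensity m τ
  fun_prop

theorem measurable_posteriorMean (y : ι → Space m) (τ : ℝ) : Measurable (posteriorMean y τ) := by
  unfold posteriorMean
  have h := (continuous_avg_gaussianDensity y τ).measurable
  refine h.inv.smul (Continuous.measurable ?_)
  simp only [avg]
  have := continuous_gaussianDensity m τ
  fun_prop

variable [Nonempty ι]

/-- Used with `c` the null posterior mean: for the full family the right side vanishes, which is the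
centring condition; for a sample it is the numerator of the score difference. -/
theorem avg_gaussianDensity_smul_sub {κ : Type*} [Fintype κ] [Nonempty κ] (S : κ → Space m)
    {τ : ℝ} (hτ : 0 < τ) (x c : Space m) :
    avg (fun j => gaussianDensity τ (x - S j) • (S j - c)) =
      avg (fun j => gaussianDensity τ (x - S j)) • (posteriorMean S τ x - c) := by
  have hp : 0 < avg (fun j => gaussianDensity τ (x - S j)) :=
    avg_pos fun i => gaussianDensity_pos hτ _
  rw [posteriorMean, smul_sub, smul_smul, mul_inv_cancel₀ hp.ne', one_smul]
  simp only [smul_sub, avg_sub]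
  congr 1
  simp only [avg, ← Finset.sum_smul, smul_assoc]

theorem norm_posteriorMean_le (y : ι → Space m) {τ : ℝ} (hτ : 0 < τ) {ρ : ℝ}
    (hy : ∀ i, ‖y i‖ ≤ ρ) (x : Space m) : ‖posteriorMean y τ x‖ ≤ ρ := by
  have hp : 0 < avg (fun i => gaussianDensity τ (x - y i)) :=
    avg_pos fun i => gaussianDensity_pos hτ _
  rw [posteriorMean, norm_smul, norm_inv, Real.norm_of_nonneg hp.le, inv_mul_le_iff₀ hp, mul_comm,
    ← avg_mul_left]
  refine (norm_avg_le _).trans (avg_mono fun i => ?_)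
  rw [norm_smul, Real.norm_of_nonneg (gaussianDensity_pos hτ _).le, mul_comm]
  exact mul_le_mul_of_nonneg_right (hy i) (gaussianDensity_pos hτ _).le

theorem avg_fisher_density_le (y : ι → Space m) {τ ρ lam : ℝ} (hτ : 0 < τ)
    (hy : ∀ i, ‖y i‖ ≤ ρ) {n : ℕ} (hn : 1 ≤ n) (hlam : 0 < lam) (x : Space m) :
    avg (fun k : Fin n → ι =>
        ‖score (familyLaw fun j => y (k j)) τ x - score (familyLaw y) τ x‖ ^ 2 *
          avg (fun j => gaussianDensity τ (x - y (k j)))) ≤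
      32 * ρ ^ 2 / τ ^ 4 * (lam / n * avg (fun i => gaussianDensity τ (x - y i)) +
        avg (fun i => if lam * avg (fun i => gaussianDensity τ (x - y i)) <
          gaussianDensity τ (x - y i) then gaussianDensity τ (x - y i) else 0)) := by
  have : Nonempty (Fin n) := ⟨⟨0, hn⟩⟩
  set u := avg (fun i => gaussianDensity τ (x - y i)) with hu
  have hu0 : 0 < u := avg_pos fun i => gaussianDensity_pos hτ _
  set c := posteriorMean y τ x with hc
  have hcρ : ‖c‖ ≤ ρ := norm_posteriorMean_le y hτ hy x
  -- Points and posterior mean both have norm at most `ρ`, so `D = 2ρ`, and `8 D² = 32 ρ²`.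
  have hmain := avg_self_normalized_le (L := fun i => gaussianDensity τ (x - y i) / u)
    (V := fun i => y i - c) (D := 2 * ρ) (lam := lam) hn
    (fun i => div_pos (gaussianDensity_pos hτ _) hu0)
    (by rw [avg_div, ← hu, div_self hu0.ne'])
    (fun i => (norm_sub_le _ _).trans (by linarith [hy i]))
    (by
      have h := avg_gaussianDensity_smul_sub y hτ x c
      rw [← hc, sub_self, smul_zero] at h
      simp only [div_eq_inv_mul, mul_smul]
      simp only [avg, ← Finset.smul_sum] at h ⊢
      rw [smul_comm, h, smul_zero]) hlam
  have hk : ∀ k : Fin n → ι,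
      ‖score (familyLaw fun j => y (k j)) τ x - score (familyLaw y) τ x‖ ^ 2 *
          avg (fun j => gaussianDensity τ (x - y (k j))) =
        u / τ ^ 4 * (‖avg (fun j => (gaussianDensity τ (x - y (k j)) / u) • (y (k j) - c))‖ ^ 2 /
          avg (fun j => gaussianDensity τ (x - y (k j)) / u)) := fun k => by
    have hp : 0 < avg (fun j => gaussianDensity τ (x - y (k j))) :=
      avg_pos fun i => gaussianDensity_pos hτ _
    have h := avg_gaussianDensity_smul_sub (fun j => y (k j)) hτ x c
    rw [score_familyLaw _ hτ, score_familyLaw _ hτ, ← smul_sub, sub_sub_sub_cancel_right, ← hc]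
    have h2 : avg (fun j => (gaussianDensity τ (x - y (k j)) / u) • (y (k j) - c)) =
        u⁻¹ • (avg (fun j => gaussianDensity τ (x - y (k j))) •
          (posteriorMean (fun j => y (k j)) τ x - c)) := by
      rw [← h]
      simp only [div_eq_inv_mul, mul_smul, avg, ← Finset.smul_sum]
      rw [smul_comm]
    rw [h2, avg_div]
    set p := avg (fun j => gaussianDensity τ (x - y (k j)))
    simp only [norm_smul, mul_pow, norm_inv, Real.norm_of_nonneg hu0.le,
      Real.norm_of_nonneg hp.le, norm_pow, Real.norm_of_nonneg hτ.le]
    field_simp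
  simp only [hk, avg_mul_left]
  refine (mul_le_mul_of_nonneg_left hmain (by positivity)).trans (le_of_eq ?_)
  have h3 : avg (fun i => if lam < gaussianDensity τ (x - y i) / u then
      gaussianDensity τ (x - y i) / u else 0) = avg (fun i => if lam * u <
          gaussianDensity τ (x - y i) then gaussianDensity τ (x - y i) else 0) / u := by
    rw [← avg_div]
    congr 1
    funext i
    simp only [lt_div_iff₀ hu0]
    split_ifs <;> simp
  rw [h3]
  field_simp
  ring

theorem lintegral_smoothed_familyLaw {κ : Type*} [Fintype κ] [Nonempty κ] (S : κ → Space m)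
    {τ : ℝ} (hτ : 0 < τ) {f : Space m → ℝ≥0∞} (hf : Measurable f) :
    ∫⁻ x, f x ∂(smoothed (familyLaw S) τ) =
      ∫⁻ x, f x * ENNReal.ofReal (avg (fun j => gaussianDensity τ (x - S j))) := by
  have : Fact (0 < τ) := ⟨hτ⟩
  have hg : Measurable fun x : Space m => ENNReal.ofReal (gaussianDensity τ x) :=
    (continuous_gaussianDensity m τ).measurable.ennreal_ofReal
  have hy : ∀ y : Space m, ∫⁻ z, f (y + z) ∂(gaussianNoise m τ) =
      ∫⁻ x, f x * ENNReal.ofReal (gaussianDensity τ (x - y)) := fun y => by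
    rw [gaussianNoise, lintegral_withDensity_eq_lintegral_mul _ hg (by fun_prop)]
    rw [← lintegral_add_left_eq_self (μ := volume)
      (fun x => f x * ENNReal.ofReal (gaussianDensity τ (x - y))) y]
    simp [mul_comm]
  rw [smoothed, Measure.lintegral_conv hf]
  simp only [hy]
  rw [familyLaw, lintegral_smul_measure, lintegral_finsetSum_measure]
  simp only [lintegral_dirac, smul_eq_mul]
  rw [← lintegral_finsetSum _ (fun j _ => by fun_prop),
    ← lintegral_const_mul _ (Finset.measurable_sum _ fun j _ => by fun_prop)]
  refine lintegral_congr fun x => ?_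
  rw [avg, smul_eq_mul, ENNReal.ofReal_mul (by positivity), ENNReal.ofReal_inv_of_pos
    (by positivity), ENNReal.ofReal_natCast,
    ENNReal.ofReal_sum_of_nonneg (fun j _ => (gaussianDensity_pos hτ _).le), ← Finset.mul_sum]
  ring

theorem ofReal_avg {κ : Type*} [Fintype κ] [Nonempty κ] {f : κ → ℝ} (hf : ∀ i, 0 ≤ f i) :
    ENNReal.ofReal (avg f) = (Fintype.card κ : ℝ≥0∞)⁻¹ * ∑ i, ENNReal.ofReal (f i) := by
  rw [avg, smul_eq_mul, ENNReal.ofReal_mul (by positivity), ENNReal.ofReal_inv_of_pos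
    (by positivity), ENNReal.ofReal_natCast, ENNReal.ofReal_sum_of_nonneg fun i _ => hf i]

theorem lintegral_avg {κ : Type*} [Fintype κ] [Nonempty κ] {f : κ → Space m → ℝ}
    (hf : ∀ i x, 0 ≤ f i x) (hm : ∀ i, Measurable (f i)) :
    ∫⁻ x, ENNReal.ofReal (avg fun i => f i x) =
      (Fintype.card κ : ℝ≥0∞)⁻¹ * ∑ i, ∫⁻ x, ENNReal.ofReal (f i x) := by
  simp only [ofReal_avg fun i => hf i _]
  rw [lintegral_const_mul _ (Finset.measurable_sum _ fun j _ => (hm j).ennreal_ofReal),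
    lintegral_finsetSum _ (fun j _ => (hm j).ennreal_ofReal)]

/-- The substitution `x = y i + z` in the `i`-th summand turns the Gaussian weight into the law of
the noise. -/
theorem lintegral_tail_density (y : ι → Space m) {τ lam : ℝ} (hτ : 0 < τ) :
    ∫⁻ x, ENNReal.ofReal (avg (fun i => if lam * avg (fun i => gaussianDensity τ (x - y i)) <
          gaussianDensity τ (x - y i) then gaussianDensity τ (x - y i) else 0)) =
      ((familyLaw y).prod (gaussianNoise m τ)) {p | lam * smoothedDensity (familyLaw y) τ
        (p.1 + p.2) < gaussianDensity τ p.2} := by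
  classical
  have := isProbabilityMeasure_gaussianNoise m hτ
  have hu : Measurable fun x => avg (fun i => gaussianDensity τ (x - y i)) :=
    (continuous_avg_gaussianDensity y τ).measurable
  have hset : MeasurableSet {p : Space m × Space m | lam * smoothedDensity (familyLaw y) τ
        (p.1 + p.2) < gaussianDensity τ p.2} := by
    simp only [smoothedDensity_familyLaw]
    exact measurableSet_lt ((hu.comp (measurable_fst.add measurable_snd)).const_mul lam)
      (by fun_prop)
  have hsi : ∀ i, MeasurableSet {x | lam * avg (fun i => gaussianDensity τ (x - y i)) <
      gaussianDensity τ (x - y i)} := fun i => measurableSet_lt (hu.const_mul lam) (by fun_prop)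
  rw [lintegral_avg (fun i x => by split_ifs; exacts [(gaussianDensity_pos hτ _).le, le_rfl])
    (fun i => Measurable.ite (hsi i) (by fun_prop) measurable_const)]
  simp only [smoothedDensity_familyLaw] at hset ⊢
  rw [Measure.prod_apply hset, familyLaw, lintegral_smul_measure, lintegral_finsetSum_measure]
  simp only [lintegral_dirac, smul_eq_mul]
  congr 1
  refine Finset.sum_congr rfl fun i _ => ?_
  rw [gaussianNoise, withDensity_apply _ (measurable_prodMk_left hset),
    ← lintegral_indicator (measurable_prodMk_left hset),
    ← lintegral_add_left_eq_self (μ := volume) _ (y i)]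
  refine lintegral_congr fun z => ?_
  rw [Set.indicator_apply]
  simp only [Set.mem_preimage, Set.mem_ofPred_eq, add_sub_cancel_left]
  split_ifs <;> simp

/-- An inequality suffices for Markov, and it spares any proof that the Fisher integral is finite.
-/
theorem ofReal_fisher_le {κ : Type*} [Fintype κ] [Nonempty κ] (y : ι → Space m)
    (S : κ → Space m) {τ : ℝ} (hτ : 0 < τ) :
    ENNReal.ofReal (∫ x, ‖score (familyLaw S) τ x - score (familyLaw y) τ x‖ ^ 2
        ∂(smoothed (familyLaw S) τ)) ≤
      ∫⁻ x, ENNReal.ofReal (‖score (familyLaw S) τ x - score (familyLaw y) τ x‖ ^ 2 *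
        avg (fun j => gaussianDensity τ (x - S j))) := by
  have hm : Measurable fun x => ‖score (familyLaw S) τ x - score (familyLaw y) τ x‖ ^ 2 := by
    simp only [score_familyLaw _ hτ]
    have h1 := measurable_posteriorMean S τ
    have h2 := measurable_posteriorMean y τ
    fun_prop
  rw [integral_eq_lintegral_of_nonneg_ae (Filter.Eventually.of_forall fun x => by positivity)
    hm.aestronglyMeasurable]
  refine ENNReal.ofReal_toReal_le.trans ?_
  rw [lintegral_smoothed_familyLaw S hτ hm.ennreal_ofReal]
  refine lintegral_mono fun x => ?_
  rw [ENNReal.ofReal_mul (by positivity)]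

theorem familyLaw_fisher_gt_le (y : ι → Space m) {τ ρ lam θ : ℝ} (hτ : 0 < τ) (hθ : 0 < θ)
    (hy : ∀ i, ‖y i‖ ≤ ρ) {n : ℕ} (hn : 1 ≤ n) (hlam : 0 < lam) :
    familyLaw (fun (k : Fin n → ι) (j : Fin n) => y (k j))
        {S | θ < ∫ x, ‖score (familyLaw S) τ x - score (familyLaw y) τ x‖ ^ 2
          ∂(smoothed (familyLaw S) τ)} ≤
      ENNReal.ofReal (32 * ρ ^ 2 / τ ^ 4 / θ) * (ENNReal.ofReal (lam / n) +
        ((familyLaw y).prod (gaussianNoise m τ)) {p | lam * smoothedDensity (familyLaw y) τ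
          (p.1 + p.2) < gaussianDensity τ p.2}) := by
  have : Nonempty (Fin n) := ⟨⟨0, hn⟩⟩
  have := isProbabilityMeasure_gaussianNoise m hτ
  have hu : Measurable fun x => avg (fun i => gaussianDensity τ (x - y i)) :=
    (continuous_avg_gaussianDensity y τ).measurable
  have hu0 : ∀ x, 0 ≤ avg (fun i => gaussianDensity τ (x - y i)) := fun x =>
    (avg_pos fun i => gaussianDensity_pos hτ _).le
  have htail0 : ∀ x, 0 ≤ avg (fun i => if lam * avg (fun i => gaussianDensity τ (x - y i)) <
      gaussianDensity τ (x - y i) then gaussianDensity τ (x - y i) else 0) := fun x =>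
    avg_nonneg fun i => by split_ifs; exacts [(gaussianDensity_pos hτ _).le, le_rfl]
  set G : (Fin n → ι) → Space m → ℝ := fun k x =>
    ‖score (familyLaw fun j => y (k j)) τ x - score (familyLaw y) τ x‖ ^ 2 *
      avg (fun j => gaussianDensity τ (x - y (k j))) with hG
  have hG0 : ∀ k x, 0 ≤ G k x := fun k x =>
    mul_nonneg (by positivity) (avg_nonneg fun i => (gaussianDensity_pos hτ _).le)
  have hGm : ∀ k, Measurable (G k) := fun k => by
    simp only [hG, score_familyLaw _ hτ]
    have h1 := measurable_posteriorMean (fun j => y (k j)) τ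
    have h2 := measurable_posteriorMean y τ
    have h3 := (continuous_avg_gaussianDensity (fun j => y (k j)) τ).measurable
    fun_prop
  have hθ' : ENNReal.ofReal θ ≠ 0 := by simpa using hθ
  have hone : ∫⁻ x, ENNReal.ofReal (avg (fun i => gaussianDensity τ (x - y i))) = 1 := by
    have h := lintegral_smoothed_familyLaw y hτ (f := fun _ => 1) measurable_const
    simp only [lintegral_one, one_mul] at h
    rw [← h, smoothed]
    exact measure_univ
  have hmarkov : familyLaw (fun (k : Fin n → ι) (j : Fin n) => y (k j))
        {S | θ < ∫ x, ‖score (familyLaw S) τ x - score (familyLaw y) τ x‖ ^ 2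
          ∂(smoothed (familyLaw S) τ)} ≤
      (∫⁻ x, ENNReal.ofReal (avg fun k => G k x)) / ENNReal.ofReal θ := by
    rw [familyLaw_apply, lintegral_avg hG0 hGm, mul_div_assoc]
    gcongr
    rw [ENNReal.le_div_iff_mul_le (Or.inl hθ') (Or.inl (by simp)), Finset.sum_mul]
    refine Finset.sum_le_sum fun k _ => ?_
    rw [Set.indicator_apply]
    split_ifs with h
    · rw [Pi.one_apply, one_mul]
      exact (ENNReal.ofReal_le_ofReal h.le).trans (ofReal_fisher_le y _ hτ)
    · simp
  refine hmarkov.trans ?_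
  rw [ENNReal.div_le_iff_le_mul (Or.inl hθ') (Or.inl (by simp)), ← lintegral_tail_density y hτ]
  calc ∫⁻ x, ENNReal.ofReal (avg fun k => G k x) ≤ ∫⁻ x, ENNReal.ofReal (32 * ρ ^ 2 / τ ^ 4) *
        (ENNReal.ofReal (lam / n) * ENNReal.ofReal (avg (fun i => gaussianDensity τ (x - y i))) +
        ENNReal.ofReal (avg (fun i => if lam * avg (fun i => gaussianDensity τ (x - y i)) <
          gaussianDensity τ (x - y i) then gaussianDensity τ (x - y i) else 0))) := by
        refine lintegral_mono fun x => ?_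
        refine (ENNReal.ofReal_le_ofReal (avg_fisher_density_le y hτ hy hn hlam x)).trans ?_
        rw [ENNReal.ofReal_mul (by positivity), ENNReal.ofReal_add
          (mul_nonneg (by positivity) (hu0 x)) (htail0 x), ENNReal.ofReal_mul (by positivity)]
    _ = ENNReal.ofReal (32 * ρ ^ 2 / τ ^ 4) * (ENNReal.ofReal (lam / n) +
        ∫⁻ x, ENNReal.ofReal (avg (fun i => if lam * avg (fun i => gaussianDensity τ (x - y i)) <
          gaussianDensity τ (x - y i) then gaussianDensity τ (x - y i) else 0))) := by
        rw [lintegral_const_mul' _ _ (by simp), lintegral_add_left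
          (hu.ennreal_ofReal.const_mul _), lintegral_const_mul _ hu.ennreal_ofReal, hone, mul_one]
    _ = _ := by
        rw [mul_right_comm, ← ENNReal.ofReal_mul (by positivity), div_mul_cancel₀ _ hθ.ne']

end Fisher

/-- The expected Fisher term is controlled by the codebook size and the upper tail of the
information density. -/
theorem codebookLaw_fisherTerm_gt_le {R γ τ lam θ : ℝ} {m n : ℕ} (hR : 0 < R) (hγ : 0 < γ)
    (hτ : 0 < τ) (hθ : 0 < θ) (hn : 1 ≤ n) (hlam : 0 < lam) :
    codebookLaw R γ m n {S | θ < fisherTerm R γ τ S} ≤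
      ENNReal.ofReal (32 * (m * R ^ 2) / τ ^ 4 / θ) * (ENNReal.ofReal (lam / n) +
        signalNoise R γ m τ {p | Real.log lam < logRatio R γ τ p.1 (p.1 + p.2)}) := by
  have := nonempty_fin_numPoints hR hγ
  have hρ : ∀ k, ‖codeword R γ m k‖ ≤ Real.sqrt (m * R ^ 2) := fun k =>
    Real.le_sqrt_of_sq_le (norm_codeword_sq m k).le
  have h := familyLaw_fisher_gt_le (codeword R γ m) hτ hθ hρ hn hlam
  rw [Real.sq_sqrt (by positivity)] at h
  simp only [codebookLaw_eq hR hγ, fisherTerm, signalNoise, nullLaw_eq hR hγ, empirical_eq]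
  convert h using 4
  ext p
  have hu : 0 < smoothedDensity (familyLaw (codeword R γ m)) τ (p.1 + p.2) := by
    rw [smoothedDensity_familyLaw]
    exact avg_pos fun i => gaussianDensity_pos hτ _
  simp only [Set.mem_ofPred_eq, logRatio, likelihoodRatio, nullLaw_eq hR hγ, add_sub_cancel_left]
  rw [Real.log_lt_log_iff hlam (div_pos (gaussianDensity_pos hτ _) hu), lt_div_iff₀ hu]

/-! ### Sub-gamma concentration for sums of i.i.d. variables -/

section Concentration

variable {Ω : Type*} [MeasurableSpace Ω] {P : Measure Ω}

/-- The sub-gamma constant of a variable dominated by `h + K` with `𝔼 exp (h / 4) ≤ 2`. -/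
def subgammaConst (K : ℝ) : ℝ := 256 * Real.exp (K / 2 + 2)

theorem subgammaConst_pos (K : ℝ) : 0 < subgammaConst K := by unfold subgammaConst; positivity

theorem integrable_of_integrable_exp {h : Ω → ℝ} (hm : Measurable h) (h0 : ∀ p, 0 ≤ h p)
    (hexp : Integrable (fun p => Real.exp (h p / 4)) P) : Integrable h P := by
  refine (hexp.const_mul 4).mono' hm.aestronglyMeasurable (Filter.Eventually.of_forall fun p => ?_)
  rw [Real.norm_of_nonneg (h0 p)]
  linarith [Real.add_one_le_exp (h p / 4)]

variable [IsProbabilityMeasure P]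

theorem integrable_of_abs_sub_le {f h : Ω → ℝ} {c₀ σ K : ℝ} (hf : Measurable f)
    (hm : Measurable h) (h0 : ∀ p, 0 ≤ h p) (hexp : Integrable (fun p => Real.exp (h p / 4)) P)
    (hfh : ∀ p, |f p - c₀| ≤ σ * (h p + K)) : Integrable f P := by
  have hi := integrable_of_integrable_exp hm h0 hexp
  have hi2 : Integrable (fun p => σ * (h p + K) + |c₀|) P :=
    ((hi.add (integrable_const K)).const_mul σ).add (integrable_const _)
  refine hi2.mono' hf.aestronglyMeasurable (Filter.Eventually.of_forall fun p => ?_)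
  have := abs_add_le (f p - c₀) c₀
  rw [sub_add_cancel] at this
  rw [Real.norm_eq_abs]
  linarith [hfh p]

theorem exp_le_one_add_sq_mul_exp_abs (x : ℝ) : Real.exp x ≤ 1 + x + x ^ 2 * Real.exp |x| := by
  have h := Complex.norm_exp_sub_sum_le_norm_mul_exp (x : ℂ) 2
  have h2 : ‖Complex.exp x - ∑ m ∈ Finset.range 2, (x : ℂ) ^ m / m.factorial‖ =
      |Real.exp x - (1 + x)| := by
    rw [← Real.norm_eq_abs, ← Complex.norm_real]
    congr 1
    simp [Finset.sum_range_succ]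
  rw [h2, Complex.norm_real, Real.norm_eq_abs, sq_abs] at h
  linarith [le_abs_self (Real.exp x - (1 + x))]

/-- From `(w/8)² / 2 ≤ exp (w/8)`. -/
theorem sq_mul_exp_le {w : ℝ} (hw : 0 ≤ w) :
    w ^ 2 * Real.exp (w / 8) ≤ 128 * Real.exp (w / 4) := by
  have h1 := Real.quadratic_le_exp_of_nonneg (by positivity : 0 ≤ w / 8)
  have h2 : Real.exp (w / 4) = Real.exp (w / 8) * Real.exp (w / 8) := by
    rw [← Real.exp_add]; congr 1; ring
  rw [h2, ← mul_assoc]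
  gcongr
  nlinarith

/-- In `exp x ≤ 1 + x + x² exp |x|` the linear term integrates to zero after centring. For `s ≤ 1/8`
the quadratic term is dominated by `s² σ²` times a multiple of `exp (h/4)`, so the small scale `σ`
survives in the exponent. -/
theorem integral_exp_sub_mean_le {f h : Ω → ℝ} {c₀ σ K s : ℝ} (hf : Measurable f)
    (hm : Measurable h) (h0 : ∀ p, 0 ≤ h p) (hexp : Integrable (fun p => Real.exp (h p / 4)) P)
    (hexp2 : ∫ p, Real.exp (h p / 4) ∂P ≤ 2) (hσ0 : 0 ≤ σ) (hσ1 : σ ≤ 1) (hK : 0 ≤ K)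
    (hfh : ∀ p, |f p - c₀| ≤ σ * (h p + K)) (hs0 : 0 ≤ s) (hs : s ≤ 1 / 8) :
    Integrable (fun p => Real.exp (s * (f p - ∫ q, f q ∂P))) P ∧
      ∫ p, Real.exp (s * (f p - ∫ q, f q ∂P)) ∂P ≤
        Real.exp (subgammaConst K * s ^ 2 * σ ^ 2) := by
  have hi := integrable_of_integrable_exp hm h0 hexp
  have hfi := integrable_of_abs_sub_le hf hm h0 hexp hfh
  have hEh : ∫ p, h p ∂P ≤ 8 := by
    calc ∫ p, h p ∂P ≤ ∫ p, 4 * Real.exp (h p / 4) ∂P :=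
          integral_mono hi (hexp.const_mul 4) fun p => by
            linarith [Real.add_one_le_exp (h p / 4)]
      _ ≤ 8 := by rw [integral_const_mul]; linarith
  set μ := ∫ q, f q ∂P with hμ
  have hmean : |μ - c₀| ≤ σ * (8 + K) := by
    have h1 : μ - c₀ = ∫ p, (f p - c₀) ∂P := by
      rw [integral_sub hfi (integrable_const _)]; simp [hμ]
    have hi2 : Integrable (fun p => σ * (h p + K)) P :=
      (hi.add (integrable_const K)).const_mul σ
    rw [h1]
    refine (abs_integral_le_integral_abs).trans ?_
    refine (integral_mono (hfi.sub (integrable_const _)).abs hi2 hfh).trans ?_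
    rw [integral_const_mul, integral_add hi (integrable_const _)]
    simp only [integral_const, probReal_univ, smul_eq_mul, one_mul]
    gcongr
  -- Replacing `c₀` by the mean adds `σ (8 + K)`, so the shift `K` becomes `2 K + 8`.
  set W : Ω → ℝ := fun p => h p + (2 * K + 8) with hW
  have hW0 : ∀ p, 0 ≤ W p := fun p => by have := h0 p; simp only [hW]; linarith
  have hX : ∀ p, |f p - μ| ≤ σ * W p := fun p => by
    have h1 := abs_sub_le (f p) c₀ μ
    rw [abs_sub_comm c₀ μ] at h1
    calc |f p - μ| ≤ σ * (h p + K) + σ * (8 + K) := by linarith [hfh p]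
      _ = σ * W p := by simp only [hW]; ring
  have hpt : ∀ p, Real.exp (s * (f p - μ)) ≤ 1 + s * (f p - μ) +
      s ^ 2 * σ ^ 2 * (128 * Real.exp ((2 * K + 8) / 4)) * Real.exp (h p / 4) := fun p => by
    refine (exp_le_one_add_sq_mul_exp_abs _).trans ?_
    have h1 : |s * (f p - μ)| ≤ W p / 8 := by
      rw [abs_mul, abs_of_nonneg hs0]
      calc s * |f p - μ| ≤ 1 / 8 * (1 * W p) := by
            gcongr
            exact (hX p).trans (mul_le_mul_of_nonneg_right hσ1 (hW0 p))
        _ = W p / 8 := by ring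
    have h2 : (s * (f p - μ)) ^ 2 ≤ s ^ 2 * σ ^ 2 * W p ^ 2 := by
      calc (s * (f p - μ)) ^ 2 = s ^ 2 * |f p - μ| ^ 2 := by rw [mul_pow, sq_abs]
        _ ≤ s ^ 2 * (σ * W p) ^ 2 := by gcongr; exact hX p
        _ = _ := by ring
    have h3 : Real.exp (W p / 4) = Real.exp ((2 * K + 8) / 4) * Real.exp (h p / 4) := by
      rw [← Real.exp_add]; congr 1; simp only [hW]; ring
    have h4 : (s * (f p - μ)) ^ 2 * Real.exp |s * (f p - μ)| ≤
        s ^ 2 * σ ^ 2 * (128 * (Real.exp ((2 * K + 8) / 4) * Real.exp (h p / 4))) := by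
      calc _ ≤ s ^ 2 * σ ^ 2 * W p ^ 2 * Real.exp (W p / 8) := by gcongr
        _ = s ^ 2 * σ ^ 2 * (W p ^ 2 * Real.exp (W p / 8)) := by ring
        _ ≤ _ := by rw [← h3]; exact mul_le_mul_of_nonneg_left (sq_mul_exp_le (hW0 p)) (by positivity)
    linarith
  have hint1 : Integrable (fun p => 1 + s * (f p - μ)) P :=
    (integrable_const _).add ((hfi.sub (integrable_const _)).const_mul s)
  have hint2 : Integrable (fun p => s ^ 2 * σ ^ 2 * (128 * Real.exp ((2 * K + 8) / 4)) *
      Real.exp (h p / 4)) P := hexp.const_mul _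
  have hint : Integrable (fun p => Real.exp (s * (f p - μ))) P := by
    refine (hint1.add hint2).mono' (by fun_prop) (Filter.Eventually.of_forall fun p => ?_)
    rw [Real.norm_of_nonneg (Real.exp_pos _).le]
    exact hpt p
  refine ⟨hint, ?_⟩
  calc ∫ p, Real.exp (s * (f p - μ)) ∂P ≤ ∫ p, (1 + s * (f p - μ) + s ^ 2 * σ ^ 2 *
        (128 * Real.exp ((2 * K + 8) / 4)) * Real.exp (h p / 4)) ∂P :=
        integral_mono hint (hint1.add hint2) hpt
    _ = 1 + s ^ 2 * σ ^ 2 * (128 * Real.exp ((2 * K + 8) / 4)) *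
        ∫ p, Real.exp (h p / 4) ∂P := by
        have hzero : ∫ p, (1 + s * (f p - μ)) ∂P = 1 := by
          have hc : Integrable (fun p => s * (f p - μ)) P :=
            (hfi.sub (integrable_const _)).const_mul s
          rw [integral_add (integrable_const _) hc, integral_const_mul,
            integral_sub hfi (integrable_const _)]
          simp [← hμ]
        rw [integral_add hint1 hint2, integral_const_mul, hzero]
    _ ≤ 1 + s ^ 2 * σ ^ 2 * (128 * Real.exp ((2 * K + 8) / 4)) * 2 := by gcongr
    _ = subgammaConst K * s ^ 2 * σ ^ 2 + 1 := by
        rw [subgammaConst, show (2 * K + 8) / 4 = K / 2 + 2 by ring]; ring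
    _ ≤ _ := Real.add_one_le_exp _

/-- Chernoff's bound: the moment generating function of the centred sum is the `m`-th power of that
of one term. -/
theorem pi_sum_tail_le {f : Ω → ℝ} {s v t : ℝ} {m : ℕ} (hs : 0 ≤ s)
    (hint : Integrable (fun p => Real.exp (s * (f p - ∫ q, f q ∂P))) P)
    (hmgf : ∫ p, Real.exp (s * (f p - ∫ q, f q ∂P)) ∂P ≤ Real.exp v) :
    (Measure.pi fun _ : Fin m => P) {p | m * (∫ q, f q ∂P) + t < ∑ j, f (p j)} ≤
      ENNReal.ofReal (Real.exp (m * v - s * t)) := by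
  set μ := ∫ q, f q ∂P with hμ
  set X : (Fin m → Ω) → ℝ := fun p => ∑ j, (f (p j) - μ) with hX
  have hprod : ∀ p, Real.exp (s * X p) = ∏ j, Real.exp (s * (f (p j) - μ)) := fun p => by
    rw [← Real.exp_sum, hX, Finset.mul_sum]
  have hint' : Integrable (fun p => Real.exp (s * X p)) (Measure.pi fun _ : Fin m => P) := by
    simp only [hprod]
    exact Integrable.fintype_prod (f := fun _ p => Real.exp (s * (f p - μ))) fun _ => hint
  have h := measure_ge_le_exp_mul_mgf (X := X) t hs hint'
  have hm : mgf X (Measure.pi fun _ : Fin m => P) s ≤ Real.exp (m * v) := by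
    rw [mgf]
    simp only [hprod]
    rw [integral_fintype_prod_eq_pow (fun p => Real.exp (s * (f p - μ))), Fintype.card_fin,
      mul_comm (m : ℝ), Real.exp_mul, Real.rpow_natCast]
    exact pow_le_pow_left₀ (integral_nonneg fun p => (Real.exp_pos _).le) hmgf m
  have hsub : {p : Fin m → Ω | m * μ + t < ∑ j, f (p j)} ⊆ {p | t ≤ X p} := fun p hp => by
    have hp' : m * μ + t < ∑ j, f (p j) := hp
    show t ≤ X p
    simp only [hX, Finset.sum_sub_distrib, Finset.sum_const, Finset.card_univ, Fintype.card_fin,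
      nsmul_eq_mul]
    linarith
  refine (measure_mono hsub).trans ?_
  rw [← ENNReal.ofReal_toReal (measure_ne_top _ {p | t ≤ X p})]
  refine ENNReal.ofReal_le_ofReal (h.trans ?_)
  calc _ ≤ Real.exp (-s * t) * Real.exp (m * v) := by gcongr
    _ = _ := by rw [← Real.exp_add]; congr 1; ring

end Concentration

/-! ### Exponential square moments of the planar Gaussian -/

/-- The value `√2` makes the corresponding planar moment exactly 2. -/
theorem integrable_exp_sq_gaussianReal :
    Integrable (fun x : ℝ => Real.exp (x ^ 2 / 4)) (gaussianReal 0 1) ∧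
      ∫ x, Real.exp (x ^ 2 / 4) ∂(gaussianReal 0 1) = Real.sqrt 2 := by
  have h1 : ∀ x : ℝ, gaussianPDFReal 0 1 x • Real.exp (x ^ 2 / 4) =
      (Real.sqrt (2 * Real.pi))⁻¹ * Real.exp (-(1 / 4) * x ^ 2) := fun x => by
    rw [gaussianPDFReal, smul_eq_mul, mul_assoc, ← Real.exp_add]
    congr 2
    · simp
    · simp; ring
  constructor
  · rw [gaussianReal_of_var_ne_zero _ one_ne_zero, gaussianPDF_def,
      integrable_withDensity_iff_integrable_smul' (by fun_prop) (by simp)]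
    simp only [ENNReal.toReal_ofReal (gaussianPDFReal_nonneg 0 1 _), h1]
    exact (integrable_exp_neg_mul_sq (by norm_num)).const_mul _
  · rw [integral_gaussianReal_eq_integral_smul one_ne_zero]
    simp only [h1]
    rw [integral_const_mul, integral_gaussian, ← Real.sqrt_inv, ← Real.sqrt_mul (by positivity)]
    congr 1
    field_simp
    norm_num

/-- The squared Euclidean norm on a planar block. -/
def planarSq (g : Fin 2 → ℝ) : ℝ := g 0 ^ 2 + g 1 ^ 2

theorem planarSq_nonneg (g : Fin 2 → ℝ) : 0 ≤ planarSq g := by unfold planarSq; positivity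

theorem exp_planarSq (g : Fin 2 → ℝ) :
    Real.exp (planarSq g / 4) = ∏ b, Real.exp (g b ^ 2 / 4) := by
  rw [← Real.exp_sum, planarSq, Fin.sum_univ_two]; congr 1; ring

theorem integrable_exp_planarSq :
    Integrable (fun g => Real.exp (planarSq g / 4)) planarGaussian := by
  simp only [exp_planarSq]
  exact Integrable.fintype_prod (f := fun _ x => Real.exp (x ^ 2 / 4))
    fun _ => integrable_exp_sq_gaussianReal.1

theorem integral_exp_planarSq : ∫ g, Real.exp (planarSq g / 4) ∂planarGaussian = 2 := by
  simp only [exp_planarSq]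
  rw [planarGaussian, integral_fintype_prod_eq_pow (fun x => Real.exp (x ^ 2 / 4)),
    integrable_exp_sq_gaussianReal.2]
  simp

/-! ### Factorization of the information density over planar blocks -/

/-- The law of a uniform circle index together with an independent planar Gaussian. -/
def blockLaw (R γ : ℝ) : Measure (Fin (numPoints R γ) × (Fin 2 → ℝ)) :=
  (familyLaw id).prod planarGaussian

/-- The log-likelihood ratio of the point `k'` against `k` when the observation is `a_k + τ g`,
with `β = 1 / τ`. -/
def blockExponent (R γ β : ℝ) (k k' : Fin (numPoints R γ)) (g : Fin 2 → ℝ) : ℝ :=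
  -(β * ∑ b, (circlePoint R γ k b - circlePoint R γ k' b) * g b) -
    β ^ 2 / 2 * ∑ b, (circlePoint R γ k b - circlePoint R γ k' b) ^ 2

/-- The information density of one planar block, with `β = 1 / τ`. -/
def blockLogRatio (R γ β : ℝ) (p : Fin (numPoints R γ) × (Fin 2 → ℝ)) : ℝ :=
  -Real.log (avg fun k' => Real.exp (blockExponent R γ β p.1 k' p.2))

variable {R γ : ℝ}

theorem isProbabilityMeasure_blockLaw (hR : 0 < R) (hγ : 0 < γ) :
    IsProbabilityMeasure (blockLaw R γ) := by
  have := nonempty_fin_numPoints hR hγ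
  unfold blockLaw; infer_instance

theorem avg_prod {ι κ : Type*} [Fintype ι] [Fintype κ] [DecidableEq κ] (f : κ → ι → ℝ) :
    avg (fun k : κ → ι => ∏ j, f j (k j)) = ∏ j, avg (f j) := by
  simp only [avg, smul_eq_mul, Fintype.card_fun, Finset.prod_mul_distrib, Finset.prod_const,
    Finset.card_univ, Finset.prod_univ_sum, Fintype.piFinset_univ]
  push_cast
  rw [inv_pow]

theorem gaussianDensity_shift {m : ℕ} {τ : ℝ} (hτ : 0 < τ)
    (k k' : Fin m → Fin (numPoints R γ)) (g : Fin m → Fin 2 → ℝ) :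
    gaussianDensity τ (codeword R γ m k + blockNoise τ g - codeword R γ m k') =
      gaussianDensity τ (blockNoise (m := m) τ g) *
        ∏ j, Real.exp (blockExponent R γ τ⁻¹ (k j) (k' j) (g j)) := by
  rw [gaussianDensity, gaussianDensity, ← Real.exp_sum, mul_assoc (_⁻¹) (Real.exp _), ← Real.exp_add]
  congr 2
  rw [EuclideanSpace.norm_sq_eq, EuclideanSpace.norm_sq_eq, Fintype.sum_prod_type,
    Fintype.sum_prod_type, ← Finset.sum_neg_distrib, ← Finset.sum_neg_distrib, Finset.sum_div,
    Finset.sum_div, ← Finset.sum_add_distrib]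
  refine Finset.sum_congr rfl fun j _ => ?_
  simp only [blockExponent, Fin.sum_univ_two, codeword, blockNoise, PiLp.sub_apply,
    PiLp.add_apply, Real.norm_eq_abs, sq_abs]
  field_simp
  ring

/-- Relative to the true noise density, each competing codeword contributes a product over blocks.
The average over the product support factorizes, and the logarithm turns it into a sum. -/
theorem logRatio_eq_sum (hR : 0 < R) (hγ : 0 < γ) {m : ℕ} {τ : ℝ} (hτ : 0 < τ)
    (k : Fin m → Fin (numPoints R γ)) (g : Fin m → Fin 2 → ℝ) :
    logRatio R γ τ (codeword R γ m k) (codeword R γ m k + blockNoise τ g) =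
      ∑ j, blockLogRatio R γ τ⁻¹ (k j, g j) := by
  have := nonempty_fin_numPoints hR hγ
  rw [logRatio, likelihoodRatio, nullLaw_eq hR hγ, smoothedDensity_familyLaw, add_sub_cancel_left]
  simp only [gaussianDensity_shift hτ]
  have h0 := gaussianDensity_pos hτ (blockNoise (m := m) τ g)
  rw [avg_mul_left, avg_prod (fun j k' => Real.exp (blockExponent R γ τ⁻¹ (k j) k' (g j))),
    div_mul_eq_div_div, div_self h0.ne', one_div, Real.log_inv, Real.log_prod
    (fun j _ => (avg_pos fun k' => Real.exp_pos _).ne'), ← Finset.sum_neg_distrib]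
  rfl

/-- Assembling planar blocks into a codeword and a noise vector. -/
def assemble (R γ : ℝ) (m : ℕ) (τ : ℝ) (p : Fin m → Fin (numPoints R γ) × (Fin 2 → ℝ)) :
    Space m × Space m :=
  (codeword R γ m (fun j => (p j).1), blockNoise τ (fun j => (p j).2))

theorem measurable_assemble (m : ℕ) (τ : ℝ) : Measurable (assemble R γ m τ) := by
  have h1 : Measurable (codeword R γ m) := measurable_of_countable _
  have h2 := measurable_blockNoise (m := m) τ
  unfold assemble
  fun_prop

theorem signalNoise_eq_map (hR : 0 < R) (hγ : 0 < γ) (m : ℕ) {τ : ℝ} (hτ : 0 < τ) :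
    signalNoise R γ m τ = (Measure.pi fun _ : Fin m => blockLaw R γ).map (assemble R γ m τ) := by
  have := nonempty_fin_numPoints hR hγ
  have hc : Measurable (codeword R γ m) := measurable_of_countable _
  have h1 : nullLaw R γ m = (Measure.pi fun _ : Fin m =>
      familyLaw (id : Fin (numPoints R γ) → Fin (numPoints R γ))).map (codeword R γ m) := by
    rw [pi_familyLaw, map_familyLaw _ hc, nullLaw_eq hR hγ]; rfl
  have h2 := (measurePreserving_arrowProdEquivProdArrow (Fin (numPoints R γ)) (Fin 2 → ℝ) (Fin m)
    (fun _ => familyLaw id) (fun _ => planarGaussian)).map_eq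
  rw [signalNoise, h1, gaussianNoise_eq_map m hτ, Measure.map_prod_map _ _ hc
    (measurable_blockNoise τ), ← h2, Measure.map_map
    (hc.prodMap (measurable_blockNoise τ)) (MeasurableEquiv.measurable _)]
  rfl

theorem measurable_logRatio (hR : 0 < R) (hγ : 0 < γ) (m : ℕ) (τ : ℝ) :
    Measurable fun p : Space m × Space m => logRatio R γ τ p.1 (p.1 + p.2) := by
  simp only [logRatio, likelihoodRatio, nullLaw_eq hR hγ, smoothedDensity_familyLaw]
  have h := (continuous_avg_gaussianDensity (codeword R γ m) τ).measurable
  refine Real.measurable_log.comp (Measurable.div (by fun_prop) (h.comp (by fun_prop)))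

theorem measurable_blockLogRatio (β : ℝ) : Measurable (blockLogRatio R γ β) := by
  refine measurable_from_prod_countable_right fun k => ?_
  unfold blockLogRatio blockExponent avg
  fun_prop

theorem dim_mul_infoRate (hR : 0 < R) (hγ : 0 < γ) {m : ℕ} (hm : 1 ≤ m) {τ : ℝ} (hτ : 0 < τ)
    (hint : Integrable (blockLogRatio R γ τ⁻¹) (blockLaw R γ)) :
    dim m * infoRate R γ m τ = m * ∫ p, blockLogRatio R γ τ⁻¹ p ∂(blockLaw R γ) := by
  have := isProbabilityMeasure_blockLaw hR hγ
  have hd : dim m ≠ 0 := by unfold dim; positivity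
  rw [infoRate, mul_div_cancel₀ _ hd, signalNoise_eq_map hR hγ m hτ,
    integral_map (measurable_assemble m τ).aemeasurable
      (measurable_logRatio hR hγ m τ).aestronglyMeasurable]
  simp only [assemble, logRatio_eq_sum hR hγ hτ]
  rw [integral_finsetSum _ fun j _ => integrable_comp_eval (μ := fun _ : Fin m => blockLaw R γ)
    (i := j) hint]
  rw [Finset.sum_congr rfl fun j _ => integral_comp_eval (μ := fun _ : Fin m => blockLaw R γ)
    (i := j) hint.aestronglyMeasurable]
  simp

theorem signalNoise_logRatio_gt (hR : 0 < R) (hγ : 0 < γ) (m : ℕ) {τ : ℝ} (hτ : 0 < τ) (a : ℝ) :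
    signalNoise R γ m τ {p | a < logRatio R γ τ p.1 (p.1 + p.2)} =
      (Measure.pi fun _ : Fin m => blockLaw R γ) {p | a < ∑ j, blockLogRatio R γ τ⁻¹ (p j)} := by
  rw [signalNoise_eq_map hR hγ m hτ, Measure.map_apply (measurable_assemble m τ)
    (measurableSet_lt measurable_const (measurable_logRatio hR hγ m τ))]
  congr 1
  ext p
  simp [assemble, logRatio_eq_sum hR hγ hτ]

theorem integrable_exp_planarSq_blockLaw (hR : 0 < R) (hγ : 0 < γ) :
    Integrable (fun p => Real.exp (planarSq p.2 / 4)) (blockLaw R γ) := by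
  have := nonempty_fin_numPoints hR hγ
  exact integrable_exp_planarSq.comp_snd _

theorem integral_exp_planarSq_blockLaw (hR : 0 < R) (hγ : 0 < γ) :
    ∫ p, Real.exp (planarSq p.2 / 4) ∂(blockLaw R γ) = 2 := by
  have := nonempty_fin_numPoints hR hγ
  rw [blockLaw, integral_fun_snd (fun g => Real.exp (planarSq g / 4)), integral_exp_planarSq]
  simp

/-! ### Bounds for log-averages of exponentials -/

section LogAvgExp

variable {ι : Type*} [Fintype ι] [Nonempty ι]

theorem log_avg_exp_le_add {e e' : ι → ℝ} {B : ℝ} (h : ∀ i, e i ≤ e' i + B) :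
    Real.log (avg fun i => Real.exp (e i)) ≤ Real.log (avg fun i => Real.exp (e' i)) + B := by
  have h1 : avg (fun i => Real.exp (e i)) ≤ Real.exp B * avg (fun i => Real.exp (e' i)) := by
    rw [← avg_mul_left]
    refine avg_mono fun i => ?_
    rw [← Real.exp_add]
    exact Real.exp_le_exp.2 (by linarith [h i])
  have h2 : 0 < avg (fun i => Real.exp (e' i)) := avg_pos fun i => Real.exp_pos _
  refine (Real.log_le_log (avg_pos fun i => Real.exp_pos _) h1).trans (le_of_eq ?_)
  rw [Real.log_mul (Real.exp_pos _).ne' h2.ne', Real.log_exp, add_comm]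

theorem abs_log_avg_exp_sub_le {e e' : ι → ℝ} {B : ℝ} (h : ∀ i, |e i - e' i| ≤ B) :
    |Real.log (avg fun i => Real.exp (e i)) - Real.log (avg fun i => Real.exp (e' i))| ≤ B := by
  have h1 := log_avg_exp_le_add (e := e) (e' := e') (B := B) fun i => by
    linarith [(abs_le.1 (h i)).2]
  have h2 := log_avg_exp_le_add (e := e') (e' := e) (B := B) fun i => by
    linarith [(abs_le.1 (h i)).1]
  rw [abs_le]
  constructor <;> linarith

end LogAvgExp

/-! ### Geometry of the discretized circle -/

variable {R γ : ℝ}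

/-- The squared distance between two circle points. -/
def chordSq (R γ : ℝ) (k k' : Fin (numPoints R γ)) : ℝ :=
  ∑ b, (circlePoint R γ k b - circlePoint R γ k' b) ^ 2

/-- The inner product of a chord with a planar vector. -/
def chordInner (R γ : ℝ) (k k' : Fin (numPoints R γ)) (g : Fin 2 → ℝ) : ℝ :=
  ∑ b, (circlePoint R γ k b - circlePoint R γ k' b) * g b

theorem chordSq_nonneg (k k' : Fin (numPoints R γ)) : 0 ≤ chordSq R γ k k' :=
  Finset.sum_nonneg fun _ _ => sq_nonneg _

theorem chordSq_eq (k k' : Fin (numPoints R γ)) :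
    chordSq R γ k k' = 4 * R ^ 2 * Real.sin (Real.pi * ((k' : ℝ) - k) / numPoints R γ) ^ 2 := by
  have h : Real.pi * ((k' : ℝ) - k) / numPoints R γ = Real.pi * k' / numPoints R γ -
    Real.pi * k / numPoints R γ := by ring
  have h2 : ∀ j : ℝ, 2 * Real.pi * j / numPoints R γ = 2 * (Real.pi * j / numPoints R γ) :=
    fun j => by ring
  simp only [chordSq, circlePoint, Fin.sum_univ_two, Matrix.cons_val_zero, Matrix.cons_val_one,
    h, h2, Real.sin_sub, Real.sin_two_mul, Real.cos_two_mul]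
  have e1 := Real.sin_sq_add_cos_sq (Real.pi * k / numPoints R γ)
  have e2 := Real.sin_sq_add_cos_sq (Real.pi * k' / numPoints R γ)
  set c := Real.cos (Real.pi * k / numPoints R γ)
  set s := Real.sin (Real.pi * k / numPoints R γ)
  set c' := Real.cos (Real.pi * k' / numPoints R γ)
  set s' := Real.sin (Real.pi * k' / numPoints R γ)
  have hs : s ^ 2 = 1 - c ^ 2 := by linarith
  have hs' : s' ^ 2 = 1 - c' ^ 2 := by linarith
  linear_combination (4 * R ^ 2 * c ^ 2 - 4 * R ^ 2 * c' ^ 2) * hs +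
    (4 * R ^ 2 * c' ^ 2 - 4 * R ^ 2 * c ^ 2) * hs'

theorem chordSq_le (k k' : Fin (numPoints R γ)) : chordSq R γ k k' ≤ 4 * R ^ 2 := by
  rw [chordSq_eq]
  have := Real.sin_sq_le_one (Real.pi * ((k' : ℝ) - k) / numPoints R γ)
  nlinarith [sq_nonneg R]

theorem chordInner_sq_le (k k' : Fin (numPoints R γ)) (g : Fin 2 → ℝ) :
    chordInner R γ k k' g ^ 2 ≤ chordSq R γ k k' * planarSq g := by
  simp only [chordInner, chordSq, planarSq, Fin.sum_univ_two]
  nlinarith [sq_nonneg ((circlePoint R γ k 0 - circlePoint R γ k' 0) * g 1 -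
    (circlePoint R γ k 1 - circlePoint R γ k' 1) * g 0)]

/-- Cauchy–Schwarz with chords of length at most `2R`, then `2 |g| ≤ |g|² + 1`. -/
theorem abs_chordInner_le (hR : 0 < R) (k k' : Fin (numPoints R γ)) (g : Fin 2 → ℝ) :
    |chordInner R γ k k' g| ≤ R * (planarSq g + 1) := by
  have h0 := planarSq_nonneg g
  refine abs_le_of_sq_le_sq ?_ (by positivity)
  have h1 := (chordInner_sq_le k k' g).trans (mul_le_mul_of_nonneg_right (chordSq_le k k') h0)
  nlinarith [mul_nonneg (sq_nonneg R) (sq_nonneg (planarSq g - 1))]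

/-- The weight `1/4` keeps a negative quadratic term: `blockExponent` lies within `|g|²` of the
range between `-3/4` and `-1/4` times `β²` times the squared chord. -/
theorem abs_mul_chordInner_le (β : ℝ) (k k' : Fin (numPoints R γ)) (g : Fin 2 → ℝ) :
    |β * chordInner R γ k k' g| ≤ planarSq g + β ^ 2 * chordSq R γ k k' / 4 := by
  simp only [chordInner, chordSq, planarSq, Fin.sum_univ_two]
  rw [abs_le]
  constructor
  · nlinarith [sq_nonneg (g 0 + β * (circlePoint R γ k 0 - circlePoint R γ k' 0) / 2),
      sq_nonneg (g 1 + β * (circlePoint R γ k 1 - circlePoint R γ k' 1) / 2)]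
  · nlinarith [sq_nonneg (g 0 - β * (circlePoint R γ k 0 - circlePoint R γ k' 0) / 2),
      sq_nonneg (g 1 - β * (circlePoint R γ k 1 - circlePoint R γ k' 1) / 2)]

theorem blockExponent_eq (β : ℝ) (k k' : Fin (numPoints R γ)) (g : Fin 2 → ℝ) :
    blockExponent R γ β k k' g =
      -(β * chordInner R γ k k' g) - β ^ 2 / 2 * chordSq R γ k k' := rfl

theorem abs_blockExponent_sub_le (hR : 0 < R) {β β' : ℝ} (k k' : Fin (numPoints R γ))
    (g : Fin 2 → ℝ) :
    |blockExponent R γ β k k' g - blockExponent R γ β' k k' g| ≤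
      |β - β'| * (R * (planarSq g + 1)) + |β ^ 2 - β' ^ 2| * (2 * R ^ 2) := by
  have h1 : blockExponent R γ β k k' g - blockExponent R γ β' k k' g =
      -((β - β') * chordInner R γ k k' g) - (β ^ 2 - β' ^ 2) * (chordSq R γ k k' / 2) := by
    simp only [blockExponent_eq]; ring
  rw [h1]
  refine (abs_sub _ _).trans ?_
  rw [abs_neg, abs_mul, abs_mul]
  gcongr
  · exact abs_chordInner_le hR k k' g
  · rw [abs_of_nonneg (div_nonneg (chordSq_nonneg k k') zero_le_two)]
    linarith [chordSq_le k k']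

theorem abs_blockLogRatio_sub_le (hR : 0 < R) (hγ : 0 < γ) (β β' : ℝ)
    (p : Fin (numPoints R γ) × (Fin 2 → ℝ)) :
    |blockLogRatio R γ β p - blockLogRatio R γ β' p| ≤
      |β - β'| * (R * (planarSq p.2 + 1)) + |β ^ 2 - β' ^ 2| * (2 * R ^ 2) := by
  have := nonempty_fin_numPoints hR hγ
  rw [blockLogRatio, blockLogRatio, neg_sub_neg, abs_sub_comm]
  exact abs_log_avg_exp_sub_le fun k' => abs_blockExponent_sub_le hR p.1 k' p.2

theorem blockLogRatio_zero (hR : 0 < R) (hγ : 0 < γ) (p : Fin (numPoints R γ) × (Fin 2 → ℝ)) :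
    blockLogRatio R γ 0 p = 0 := by
  have := nonempty_fin_numPoints hR hγ
  simp [blockLogRatio, blockExponent, avg_const]

/-- The Gaussian kernel average over the circle, seen from one of its points. -/
def chordKernel (R γ c β : ℝ) : ℝ :=
  avg fun j : Fin (numPoints R γ) =>
    Real.exp (-(c * β ^ 2 * (4 * R ^ 2 * Real.sin (Real.pi * j / numPoints R γ) ^ 2)))

/-- Rotation invariance: reindex by `k' = k + j` modulo `M`. A wrap-around shifts the argument of
the sine by a multiple of `π`, which its square ignores. -/
theorem avg_exp_chordSq (c β : ℝ) (k : Fin (numPoints R γ)) :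
    avg (fun k' => Real.exp (-(c * β ^ 2 * chordSq R γ k k'))) = chordKernel R γ c β := by
  have hM : 0 < numPoints R γ := k.pos
  have : NeZero (numPoints R γ) := ⟨hM.ne'⟩
  have hM' : (numPoints R γ : ℝ) ≠ 0 := by positivity
  rw [chordKernel, avg, avg]
  congr 1
  rw [← Equiv.sum_comp (Equiv.addLeft k)]
  refine Finset.sum_congr rfl fun j _ => ?_
  rw [chordSq_eq]
  congr 4
  have hmod : (((k + j : Fin (numPoints R γ)) : ℕ) : ℝ) =
      k + j - numPoints R γ * (((k : ℕ) + j) / numPoints R γ : ℕ) := by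
    rw [Fin.val_add, eq_sub_iff_add_eq]
    exact_mod_cast Nat.mod_add_div _ _
  rw [Equiv.coe_addLeft, hmod]
  set N := ((k : ℕ) + j) / numPoints R γ
  have harg : Real.pi * ((k : ℝ) + j - numPoints R γ * N - k) / numPoints R γ =
      Real.pi * j / numPoints R γ - N * Real.pi := by
    field_simp
    ring
  rw [harg, Real.sin_sub_nat_mul_pi, mul_pow, ← pow_mul, mul_comm N 2, pow_mul]
  simp

theorem chordKernel_ge (hR : 0 < R) {τ : ℝ} (hγ : 0 < γ) (hγτ : γ ≤ τ) (hτR : τ ≤ R) :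
    Real.exp (-3) * (τ / (R * Real.pi)) ≤ chordKernel R γ (3 / 4) τ⁻¹ := by
  have hτ : 0 < τ := hγ.trans_le hγτ
  have hM := numPoints_pos hR hγ
  have hM' : (0 : ℝ) < numPoints R γ := by exact_mod_cast hM
  have hpi := Real.pi_gt_three
  -- Indices `j ≤ w` have half-angle `π j / M ≤ τ / R`, so each contributes at least `exp (-3)`;
  -- they form at least a fraction `w / M` of all points.
  set w := (numPoints R γ : ℝ) * τ / (R * Real.pi) with hw
  have hw0 : 0 ≤ w := by positivity
  have hwM : w < numPoints R γ := by
    rw [hw, div_lt_iff₀ (by positivity)]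
    have : τ < R * Real.pi := by nlinarith
    gcongr
  have hterm : ∀ j ∈ Finset.range (⌊w⌋₊ + 1), Real.exp (-3) ≤ Real.exp (-(3 / 4 * τ⁻¹ ^ 2 *
      (4 * R ^ 2 * Real.sin (Real.pi * (j : ℕ) / numPoints R γ) ^ 2))) := fun j hj => by
    have hjw : (j : ℝ) ≤ w :=
      (Nat.le_floor_iff hw0).1 (Nat.lt_succ_iff.1 (Finset.mem_range.1 hj))
    apply Real.exp_le_exp.2
    have hx0 : 0 ≤ Real.pi * j / numPoints R γ := by positivity
    have hx1 : Real.pi * j / numPoints R γ ≤ τ / R := by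
      rw [hw, le_div_iff₀ (by positivity)] at hjw
      rw [div_le_div_iff₀ hM' hR]
      linarith
    have hsin : Real.sin (Real.pi * j / numPoints R γ) ^ 2 ≤ (τ / R) ^ 2 := by
      rw [← sq_abs]
      have h := (Real.abs_sin_le_abs (x := Real.pi * j / numPoints R γ))
      rw [abs_of_nonneg hx0] at h
      exact pow_le_pow_left₀ (abs_nonneg _) (h.trans hx1) 2
    have h2 : 3 / 4 * τ⁻¹ ^ 2 * (4 * R ^ 2 * Real.sin (Real.pi * j / numPoints R γ) ^ 2) ≤
        3 / 4 * τ⁻¹ ^ 2 * (4 * R ^ 2 * (τ / R) ^ 2) := by gcongr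
    have h3 : 3 / 4 * τ⁻¹ ^ 2 * (4 * R ^ 2 * (τ / R) ^ 2) = 3 := by field_simp
    linarith
  have hsub : Finset.range (⌊w⌋₊ + 1) ⊆ Finset.range (numPoints R γ) := by
    refine Finset.range_subset_range.2 (Nat.succ_le_of_lt ?_)
    exact (Nat.floor_lt hw0).2 hwM
  rw [chordKernel, avg, smul_eq_mul, Fintype.card_fin,
    Fin.sum_univ_eq_sum_range (fun j => Real.exp (-(3 / 4 * τ⁻¹ ^ 2 *
      (4 * R ^ 2 * Real.sin (Real.pi * (j : ℕ) / numPoints R γ) ^ 2)))), le_inv_mul_iff₀ hM']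
  calc (numPoints R γ : ℝ) * (Real.exp (-3) * (τ / (R * Real.pi))) = w * Real.exp (-3) := by
        rw [hw]; ring
    _ ≤ (⌊w⌋₊ + 1 : ℕ) * Real.exp (-3) := by
        gcongr; push_cast; exact (Nat.lt_floor_add_one w).le
    _ = ∑ j ∈ Finset.range (⌊w⌋₊ + 1), Real.exp (-3) := by simp
    _ ≤ _ := (Finset.sum_le_sum hterm).trans
        (Finset.sum_le_sum_of_subset_of_nonneg hsub fun _ _ _ => (Real.exp_pos _).le)

theorem sum_exp_neg_mul_le {x : ℝ} (hx : 0 < x) (N : ℕ) :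
    ∑ j ∈ Finset.range N, Real.exp (-x) ^ j ≤ 1 + 1 / x := by
  have hr : Real.exp (-x) < 1 := Real.exp_lt_one_iff.2 (by linarith)
  have h1 : ∑ j ∈ Finset.range N, Real.exp (-x) ^ j ≤ (1 - Real.exp (-x))⁻¹ := by
    rw [← tsum_geometric_of_lt_one (Real.exp_pos _).le hr]
    exact (summable_geometric_of_lt_one (Real.exp_pos _).le hr).sum_le_tsum _
      fun _ _ => by positivity
  have h2 : Real.exp (-x) ≤ 1 / (1 + x) := by
    rw [Real.exp_neg, inv_eq_one_div]
    gcongr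
    linarith [Real.add_one_le_exp x]
  have h3 : 1 + 1 / x = (1 - 1 / (1 + x))⁻¹ := by
    have : (1 : ℝ) + x ≠ 0 := by positivity
    rw [show 1 - 1 / (1 + x) = x / (1 + x) by field_simp; ring, inv_div]
    field_simp
    ring
  rw [h3]
  refine h1.trans (inv_anti₀ ?_ (by linarith))
  rw [sub_pos, div_lt_one (by positivity)]
  linarith

theorem chordKernel_le (hR : 0 < R) {τ : ℝ} (hγ : 0 < γ) (hγτ : γ ≤ τ) :
    chordKernel R γ (1 / 4) τ⁻¹ ≤ 2 * Real.exp (1 / 4) * (τ / R) := by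
  have hτ : 0 < τ := hγ.trans_le hγτ
  have hM := numPoints_pos hR hγ
  have hM' : (0 : ℝ) < numPoints R γ := by exact_mod_cast hM
  have hpi := Real.pi_gt_three
  set q := (numPoints R γ : ℝ) * τ / R with hq
  -- The circle is discretized finely enough for `τ ≥ γ`: `q ≥ π`. This later gives `1 + q/2 ≤ q`.
  have hq2 : 2 ≤ q := by
    have h1 := numPoints_ge R γ
    have h2 : Real.pi * (R / γ) * τ / R ≤ q := by rw [hq]; gcongr
    have h3 : Real.pi ≤ Real.pi * (R / γ) * τ / R := by
      have : Real.pi * (R / γ) * τ / R = Real.pi * (τ / γ) := by field_simp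
      rw [this]
      exact le_mul_of_one_le_right Real.pi_pos.le ((one_le_div hγ).2 hγτ)
    linarith
  set r := Real.exp (-(2 / q)) with hr
  have hr0 : 0 < r := Real.exp_pos _
  have hr1 : r ≤ 1 := Real.exp_le_one_iff.2 (by have : 0 ≤ 2 / q := by positivity
                                                linarith)
  have hbase : ∀ j : ℕ, (j : ℝ) ≤ numPoints R γ / 2 → Real.exp (-(1 / 4 * τ⁻¹ ^ 2 *
      (4 * R ^ 2 * Real.sin (Real.pi * (j : ℕ) / numPoints R γ) ^ 2))) ≤
        Real.exp (1 / 4) * r ^ j := fun j hj => by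
    rw [hr, ← Real.exp_nat_mul, ← Real.exp_add]
    apply Real.exp_le_exp.2
    have hs := Real.mul_le_sin (x := Real.pi * j / numPoints R γ) (by positivity) (by
      rw [div_le_div_iff₀ hM' two_pos]; nlinarith)
    have hs' : 2 / Real.pi * (Real.pi * j / numPoints R γ) = 2 * j / numPoints R γ := by
      field_simp
    rw [hs'] at hs
    have hs2 : (2 * j / numPoints R γ : ℝ) ^ 2 ≤
        Real.sin (Real.pi * j / numPoints R γ) ^ 2 := pow_le_pow_left₀ (by positivity) hs 2
    have h1 : 1 / 4 * τ⁻¹ ^ 2 * (4 * R ^ 2 * (2 * j / numPoints R γ : ℝ) ^ 2) ≤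
        1 / 4 * τ⁻¹ ^ 2 * (4 * R ^ 2 * Real.sin (Real.pi * j / numPoints R γ) ^ 2) := by gcongr
    have h2 : 1 / 4 * τ⁻¹ ^ 2 * (4 * R ^ 2 * (2 * j / numPoints R γ : ℝ) ^ 2) =
        (j * (2 / q)) ^ 2 := by rw [hq]; field_simp
    -- With `v = 2 j / q`, the bound `v² ≥ v - 1/4` replaces the Gaussian sum by a geometric one.
    nlinarith [sq_nonneg (j * (2 / q) - 1 / 2)]
  have hterm : ∀ j ∈ Finset.range (numPoints R γ), Real.exp (-(1 / 4 * τ⁻¹ ^ 2 *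
      (4 * R ^ 2 * Real.sin (Real.pi * (j : ℕ) / numPoints R γ) ^ 2))) ≤
        -- The second half of the circle is reflected by `j ↦ M - j`; weakening the power to `M - 1
        -- - j` makes the two sums identical after reversal.
        Real.exp (1 / 4) * r ^ j + Real.exp (1 / 4) * r ^ (numPoints R γ - 1 - j) := fun j hj => by
    have hj' := Finset.mem_range.1 hj
    rcases le_total (j : ℝ) (numPoints R γ / 2) with h | h
    · exact (hbase j h).trans (le_add_of_nonneg_right (by positivity))
    · have hcast : ((numPoints R γ - j : ℕ) : ℝ) = numPoints R γ - j := by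
        rw [Nat.cast_sub hj'.le]
      have h1 := hbase (numPoints R γ - j) (by rw [hcast]; linarith)
      have h2 : Real.pi * ((numPoints R γ - j : ℕ) : ℝ) / numPoints R γ =
          Real.pi - Real.pi * j / numPoints R γ := by rw [hcast]; field_simp
      rw [h2, Real.sin_pi_sub] at h1
      refine (h1.trans ?_).trans (le_add_of_nonneg_left (by positivity))
      exact mul_le_mul_of_nonneg_left (pow_le_pow_of_le_one hr0.le hr1 (by omega))
        (Real.exp_pos _).le
  rw [chordKernel, avg, smul_eq_mul, Fintype.card_fin,
    Fin.sum_univ_eq_sum_range (fun j => Real.exp (-(1 / 4 * τ⁻¹ ^ 2 *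
      (4 * R ^ 2 * Real.sin (Real.pi * (j : ℕ) / numPoints R γ) ^ 2)))), inv_mul_le_iff₀ hM']
  refine (Finset.sum_le_sum hterm).trans ?_
  rw [Finset.sum_add_distrib, ← Finset.mul_sum, ← Finset.mul_sum,
    Finset.sum_range_reflect (fun j => r ^ j)]
  have h1 := sum_exp_neg_mul_le (x := 2 / q) (by positivity) (numPoints R γ)
  rw [← hr] at h1
  have h2 : 1 + 1 / (2 / q) ≤ q := by
    rw [one_div_div]; linarith
  have h3 : (numPoints R γ : ℝ) * (2 * Real.exp (1 / 4) * (τ / R)) = 2 * Real.exp (1 / 4) * q := by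
    rw [hq]; ring
  rw [h3]
  have h4 := mul_le_mul_of_nonneg_left (h1.trans h2) (Real.exp_pos (1 / 4)).le
  linarith

/-- Both kernels are of order `τ / R`, so their ratio is bounded: `2π · exp (1/4) · exp 3 ≤ exp 6`.
-/
theorem log_chordKernel_le (hR : 0 < R) {τ : ℝ} (hγ : 0 < γ) (hγτ : γ ≤ τ) (hτR : τ ≤ R) :
    Real.log (chordKernel R γ (1 / 4) τ⁻¹) ≤ Real.log (chordKernel R γ (3 / 4) τ⁻¹) + 6 := by
  have := nonempty_fin_numPoints hR hγ
  have hτ : 0 < τ := hγ.trans_le hγτ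
  have h1 := chordKernel_le hR hγ hγτ
  have h2 := chordKernel_ge hR hγ hγτ hτR
  have p1 : 0 < chordKernel R γ (1 / 4) τ⁻¹ := avg_pos fun _ => Real.exp_pos _
  have p2 : 0 < chordKernel R γ (3 / 4) τ⁻¹ := avg_pos fun _ => Real.exp_pos _
  have he : 2 * Real.pi ≤ Real.exp 2 := by
    have e1 := Real.exp_one_gt_d9
    have e2 : Real.exp 2 = Real.exp 1 * Real.exp 1 := by rw [← Real.exp_add]; norm_num
    have := Real.pi_lt_d2
    nlinarith
  have h3 : chordKernel R γ (1 / 4) τ⁻¹ ≤ Real.exp 6 * chordKernel R γ (3 / 4) τ⁻¹ := by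
    calc _ ≤ 2 * Real.exp (1 / 4) * (τ / R) := h1
      _ = 2 * Real.pi * Real.exp (1 / 4) * (τ / (R * Real.pi)) := by field_simp
      _ ≤ Real.exp 2 * Real.exp 1 * (τ / (R * Real.pi)) := by gcongr; norm_num
      _ = Real.exp 6 * (Real.exp (-3) * (τ / (R * Real.pi))) := by
          rw [← mul_assoc, ← Real.exp_add, ← Real.exp_add]; norm_num
      _ ≤ _ := by gcongr
  have h4 := Real.log_le_log p1 h3
  rw [Real.log_mul (Real.exp_pos _).ne' p2.ne', Real.log_exp] at h4
  linarith

/-- The information density of a block is concentrated at scale `min 1 (R / τ)`. -/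
theorem exists_abs_blockLogRatio_sub_le (hR : 0 < R) (hγ : 0 < γ) {τ : ℝ} (hγτ : γ ≤ τ) :
    ∃ c₀ : ℝ, ∀ p, |blockLogRatio R γ τ⁻¹ p - c₀| ≤ min 1 (R / τ) * (planarSq p.2 + 6) := by
  have := nonempty_fin_numPoints hR hγ
  have hτ : 0 < τ := hγ.trans_le hγτ
  rcases le_total τ R with h | h
  · refine ⟨-Real.log (chordKernel R γ (3 / 4) τ⁻¹), fun p => ?_⟩
    rw [min_eq_left ((one_le_div hτ).2 h), one_mul, blockLogRatio]
    have hb : ∀ k', |τ⁻¹ * chordInner R γ p.1 k' p.2| ≤ _ := fun k' =>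
      abs_mul_chordInner_le τ⁻¹ p.1 k' p.2
    have h1 := log_avg_exp_le_add (e := fun k' => blockExponent R γ τ⁻¹ p.1 k' p.2)
      (e' := fun k' => -(1 / 4 * τ⁻¹ ^ 2 * chordSq R γ p.1 k')) (B := planarSq p.2) fun k' => by
        rw [blockExponent_eq]
        linarith [(abs_le.1 (hb k')).1]
    have h2 := log_avg_exp_le_add (e' := fun k' => blockExponent R γ τ⁻¹ p.1 k' p.2)
      (e := fun k' => -(3 / 4 * τ⁻¹ ^ 2 * chordSq R γ p.1 k')) (B := planarSq p.2) fun k' => by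
        rw [blockExponent_eq]
        linarith [(abs_le.1 (hb k')).2]
    rw [avg_exp_chordSq] at h1 h2
    have h3 := log_chordKernel_le hR hγ hγτ h
    rw [abs_le]
    constructor <;> linarith
  -- Here the noise exceeds the radius, and the comparison is with `β = 0`, where the information
  -- density vanishes.
  · refine ⟨0, fun p => ?_⟩
    rw [min_eq_right ((div_le_one hτ).2 h)]
    have h1 := abs_blockLogRatio_sub_le hR hγ τ⁻¹ 0 p
    rw [blockLogRatio_zero hR hγ] at h1
    refine h1.trans ?_
    have h0 := planarSq_nonneg p.2
    have hx : R / τ ≤ 1 := (div_le_one hτ).2 h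
    have hx0 : 0 < R / τ := by positivity
    have e1 : |τ⁻¹ - 0| * (R * (planarSq p.2 + 1)) = R / τ * (planarSq p.2 + 1) := by
      rw [sub_zero, abs_of_pos (by positivity)]; field_simp
    have e2 : |τ⁻¹ ^ 2 - 0 ^ 2| * (2 * R ^ 2) = 2 * (R / τ) * (R / τ) := by
      rw [zero_pow two_ne_zero, sub_zero, abs_of_pos (by positivity)]; field_simp
    rw [e1, e2]
    nlinarith

variable {R γ : ℝ}

/-! ### Comparison of the information rates at the two noise levels -/

/-- The change is of order `d⁻²`, so that a block term moves by `O(d⁻²)` and the sum over `m` blocks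
stays bounded in mean. -/
theorem inv_reducedNoise_bounds (hR : 0 < R) (hγ : 0 < γ) (hγR : γ < R / 2) {m : ℕ} (hm : 1 ≤ m)
    {τ : ℝ} (hγτ : γ ≤ τ) :
    0 < reducedNoise R γ m τ ∧ reducedNoise R γ m τ ≤ τ ∧
      |(reducedNoise R γ m τ)⁻¹ - τ⁻¹| ≤ 1 / (R * dim m ^ 2) ∧
      |(reducedNoise R γ m τ)⁻¹ ^ 2 - τ⁻¹ ^ 2| ≤ 2 / (R ^ 2 * dim m ^ 2) := by
  have hτ : 0 < τ := hγ.trans_le hγτ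
  have hm' : (1 : ℝ) ≤ m := by exact_mod_cast hm
  have hd : 2 ≤ dim m := by unfold dim; linarith
  set d := dim m
  set x := γ ^ 2 / (R ^ 2 * d ^ 2) with hx
  have hx0 : 0 < x := by positivity
  have hx1 : x ≤ 1 / 2 := by
    rw [hx, div_le_iff₀ (by positivity)]
    have h1 : γ ^ 2 ≤ (R / 2) ^ 2 := by gcongr
    have h2 : R ^ 2 * 2 ^ 2 ≤ R ^ 2 * d ^ 2 := by gcongr
    nlinarith [sq_nonneg R]
  set a := Real.sqrt (1 - x) with ha
  have ha2 : a ^ 2 = 1 - x := Real.sq_sqrt (by linarith)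
  have ha0 : 0 < a := Real.sqrt_pos.2 (by linarith)
  have ha1 : a ≤ 1 := Real.sqrt_le_one.2 (by linarith)
  have hr : reducedNoise R γ m τ = a * τ := rfl
  have hγτ1 : γ / τ ≤ 1 := (div_le_one hτ).2 hγτ
  have hinv : 1 ≤ a⁻¹ := (one_le_inv₀ ha0).2 ha1
  have hsq : a⁻¹ ^ 2 - 1 ≤ 2 * x := by
    rw [inv_pow, ha2, sub_le_iff_le_add, inv_le_iff_one_le_mul₀ (by linarith)]
    nlinarith
  have hlin : a⁻¹ - 1 ≤ x := by nlinarith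
  have hβx : τ⁻¹ ^ 2 * x ≤ 1 / (R ^ 2 * d ^ 2) := by
    have : τ⁻¹ ^ 2 * x = (γ / τ) ^ 2 * (1 / (R ^ 2 * d ^ 2)) := by rw [hx]; field_simp
    rw [this]
    exact mul_le_of_le_one_left (by positivity) (pow_le_one₀ (by positivity) hγτ1)
  have hβx' : τ⁻¹ * x ≤ 1 / (R * d ^ 2) := by
    have : τ⁻¹ * x = (γ / τ) * (γ / R) * (1 / (R * d ^ 2)) := by rw [hx]; field_simp
    rw [this]
    have hγR1 : γ / R ≤ 1 := (div_le_one hR).2 (by linarith)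
    exact mul_le_of_le_one_left (by positivity) (mul_le_one₀ hγτ1 (by positivity) hγR1)
  have hβ : 0 < τ⁻¹ := by positivity
  refine ⟨by rw [hr]; positivity, by rw [hr]; exact mul_le_of_le_one_left hτ.le ha1, ?_, ?_⟩
  · have e : (a * τ)⁻¹ - τ⁻¹ = τ⁻¹ * (a⁻¹ - 1) := by rw [mul_inv]; ring
    rw [hr, e, abs_of_nonneg (mul_nonneg hβ.le (by linarith))]
    exact (mul_le_mul_of_nonneg_left hlin hβ.le).trans hβx'
  · have e : (a * τ)⁻¹ ^ 2 - τ⁻¹ ^ 2 = τ⁻¹ ^ 2 * (a⁻¹ ^ 2 - 1) := by rw [mul_inv]; ring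
    rw [hr, e, abs_of_nonneg (mul_nonneg (by positivity) (by nlinarith))]
    calc _ ≤ τ⁻¹ ^ 2 * (2 * x) := by gcongr
      _ = 2 * (τ⁻¹ ^ 2 * x) := by ring
      _ ≤ 2 * (1 / (R ^ 2 * d ^ 2)) := by gcongr
      _ = _ := by ring

theorem measurable_planarSq_snd :
    Measurable fun p : Fin (numPoints R γ) × (Fin 2 → ℝ) => planarSq p.2 := by
  unfold planarSq; fun_prop

theorem integrable_blockLogRatio (hR : 0 < R) (hγ : 0 < γ) {τ : ℝ} (hγτ : γ ≤ τ) :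
    Integrable (blockLogRatio R γ τ⁻¹) (blockLaw R γ) := by
  have := isProbabilityMeasure_blockLaw hR hγ
  obtain ⟨c₀, hc⟩ := exists_abs_blockLogRatio_sub_le hR hγ hγτ
  exact integrable_of_abs_sub_le (measurable_blockLogRatio _) measurable_planarSq_snd
    (fun p => planarSq_nonneg _) (integrable_exp_planarSq_blockLaw hR hγ) hc

theorem integral_planarSq_blockLaw_le (hR : 0 < R) (hγ : 0 < γ) :
    ∫ p, planarSq p.2 ∂(blockLaw R γ) ≤ 8 := by
  have hexp := integrable_exp_planarSq_blockLaw hR hγ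
  calc ∫ p, planarSq p.2 ∂(blockLaw R γ) ≤
        ∫ p, 4 * Real.exp (planarSq p.2 / 4) ∂(blockLaw R γ) :=
        integral_mono (integrable_of_integrable_exp measurable_planarSq_snd
          (fun p => planarSq_nonneg _) hexp) (hexp.const_mul 4) fun p => by
            linarith [Real.add_one_le_exp (planarSq p.2 / 4)]
    _ ≤ 8 := by rw [integral_const_mul, integral_exp_planarSq_blockLaw hR hγ]; norm_num

/-- The two noise levels are so close that the Lipschitz bound in `1/τ` suffices, without
monotonicity of the information rate. -/
theorem block_mean_le_infoRate (hR : 0 < R) (hγ : 0 < γ) (hγR : γ < R / 2) {m : ℕ} (hm : 1 ≤ m)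
    {τ : ℝ} (hγτ : γ ≤ τ) :
    m * ∫ p, blockLogRatio R γ τ⁻¹ p ∂(blockLaw R γ) ≤
      dim m * infoRate R γ m (reducedNoise R γ m τ) + 4 := by
  have := isProbabilityMeasure_blockLaw hR hγ
  obtain ⟨hρ0, -, hb1, hb2⟩ := inv_reducedNoise_bounds hR hγ hγR hm hγτ
  set ρ := reducedNoise R γ m τ
  have hm' : (1 : ℝ) ≤ m := by exact_mod_cast hm
  have hd : 0 < dim m := by unfold dim; linarith
  have hexp := integrable_exp_planarSq_blockLaw hR hγ
  have hdiff : ∀ p, |blockLogRatio R γ ρ⁻¹ p - blockLogRatio R γ τ⁻¹ p| ≤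
      1 / dim m ^ 2 * (planarSq p.2 + 5) := fun p => by
    have h0 := planarSq_nonneg p.2
    refine (abs_blockLogRatio_sub_le hR hγ ρ⁻¹ τ⁻¹ p).trans ?_
    calc _ ≤ 1 / (R * dim m ^ 2) * (R * (planarSq p.2 + 1)) +
          2 / (R ^ 2 * dim m ^ 2) * (2 * R ^ 2) := by gcongr
      _ = _ := by field_simp; ring
  have hiτ := integrable_blockLogRatio hR hγ hγτ
  -- The reduced noise may fall below `γ`, outside the range of `integrable_blockLogRatio`;
  -- integrability is transferred from `τ` through the difference.
  have hid : Integrable (fun p => blockLogRatio R γ ρ⁻¹ p - blockLogRatio R γ τ⁻¹ p)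
      (blockLaw R γ) := by
    refine integrable_of_abs_sub_le (c₀ := 0) (σ := 1 / dim m ^ 2) (K := 5)
      ((measurable_blockLogRatio _).sub (measurable_blockLogRatio _)) measurable_planarSq_snd
      (fun p => planarSq_nonneg _) hexp fun p => ?_
    rw [sub_zero]
    exact hdiff p
  have hiρ : Integrable (blockLogRatio R γ ρ⁻¹) (blockLaw R γ) :=
    (hid.add hiτ).congr (Filter.Eventually.of_forall fun p => by simp)
  have hih : Integrable (fun p => 1 / dim m ^ 2 * (planarSq p.2 + 5)) (blockLaw R γ) :=
    ((integrable_of_integrable_exp measurable_planarSq_snd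
      (fun p => planarSq_nonneg _) hexp).add (integrable_const 5)).const_mul _
  rw [dim_mul_infoRate hR hγ hm hρ0 hiρ]
  have h1 : ∫ p, blockLogRatio R γ τ⁻¹ p ∂(blockLaw R γ) -
      ∫ p, blockLogRatio R γ ρ⁻¹ p ∂(blockLaw R γ) ≤ 1 / dim m ^ 2 * 13 := by
    rw [← integral_sub hiτ hiρ]
    refine (integral_mono (hiτ.sub hiρ) hih fun p => ?_).trans ?_
    · have := (abs_le.1 (hdiff p)).1
      simp only [Pi.sub_apply]
      linarith
    · rw [integral_const_mul, integral_add (integrable_of_integrable_exp measurable_planarSq_snd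
        (fun p => planarSq_nonneg _) hexp) (integrable_const _)]
      simp only [integral_const, probReal_univ, smul_eq_mul, one_mul]
      have := integral_planarSq_blockLaw_le hR hγ
      gcongr
      linarith
  have h2 : (m : ℝ) * (1 / dim m ^ 2 * 13) ≤ 4 := by
    have : (m : ℝ) * (1 / dim m ^ 2 * 13) = 13 / 4 / m := by unfold dim; field_simp; norm_num
    rw [this, div_le_iff₀ (by positivity)]
    linarith
  have h3 := mul_le_mul_of_nonneg_left h1 (by positivity : (0 : ℝ) ≤ m)
  linarith

/-! ### The large-sample theorem -/

theorem signalNoise_tail_le (hR : 0 < R) (hγ : 0 < γ) (m : ℕ) {τ : ℝ} (hγτ : γ ≤ τ)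
    {s : ℝ} (hs0 : 0 ≤ s) (hs : s ≤ 1 / 8) (t : ℝ) :
    signalNoise R γ m τ {p | m * (∫ p, blockLogRatio R γ τ⁻¹ p ∂(blockLaw R γ)) + t <
        logRatio R γ τ p.1 (p.1 + p.2)} ≤
      ENNReal.ofReal (Real.exp
        (m * (subgammaConst 6 * s ^ 2 * min 1 (R / τ) ^ 2) - s * t)) := by
  have := isProbabilityMeasure_blockLaw hR hγ
  have hτ : 0 < τ := hγ.trans_le hγτ
  obtain ⟨c₀, hc⟩ := exists_abs_blockLogRatio_sub_le hR hγ hγτ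
  have h := integral_exp_sub_mean_le (measurable_blockLogRatio _) measurable_planarSq_snd
    (fun p => planarSq_nonneg _) (integrable_exp_planarSq_blockLaw hR hγ)
    (integral_exp_planarSq_blockLaw hR hγ).le (le_min zero_le_one (by positivity))
    (min_le_left _ _) (by norm_num) hc hs0 hs
  rw [signalNoise_logRatio_gt hR hγ m hτ]
  exact pi_sum_tail_le hs0 h.1 h.2

/-- Covers both error terms at once, using `R / τ ≤ R / τ̃`. -/
theorem le_min_err {C : ℝ} (hC : 0 ≤ C) (hR : 0 < R) (hγ : 0 < γ) (hγR : γ < R / 2) {m : ℕ}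
    (hm : 1 ≤ m) {τ : ℝ} (hγτ : γ ≤ τ) (δ : ℝ) (θ : ℝ → ℝ) :
    C * (min 1 (R / τ) * Real.sqrt (dim m * logFactor C R γ m δ θ τ) +
      logFactor C R γ m δ θ τ) ≤ min (errMed C R γ m δ θ τ) (errBig C R γ m δ θ τ) := by
  obtain ⟨hρ0, hρ, -, -⟩ := inv_reducedNoise_bounds hR hγ hγR hm hγτ
  set S := Real.sqrt (dim m * logFactor C R γ m δ θ τ)
  have hS : 0 ≤ S := Real.sqrt_nonneg _
  have h1 : min 1 (R / τ) * S ≤ S := mul_le_of_le_one_left hS (min_le_left _ _)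
  have h2 : min 1 (R / τ) * S ≤ R / reducedNoise R γ m τ * S := by
    gcongr
    exact (min_le_right _ _).trans (by gcongr)
  refine le_min ?_ ?_
  · rw [errMed]
    nlinarith [mul_le_mul_of_nonneg_left h1 hC]
  · rw [errBig, mul_assoc]
    nlinarith [mul_le_mul_of_nonneg_left h2 hC]

/-- This explains the form of `logFactor`: its argument exceeds the Markov prefactor over `δ`. After
cancellation the left side is at most `δ · (16/C) (γ/τ)² / (m log(1 + |𝒱|))`, and the logarithm is
at least `log 2 ≥ 1/2`. -/
theorem exp_neg_logFactor_le {C : ℝ} (hC : 32 ≤ C) (hR : 0 < R) (hγ : 0 < γ) {m : ℕ}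
    (hm : 1 ≤ m) {τ : ℝ} (hγτ : γ ≤ τ) {δ : ℝ} (hδ : 0 < δ) {θ : ℝ → ℝ} (hθ : 0 < θ τ) :
    32 * (m * R ^ 2) / τ ^ 4 / θ τ * (2 * Real.exp (-logFactor C R γ m δ θ τ)) ≤ δ := by
  have := nonempty_fin_numPoints hR hγ
  have hτ : 0 < τ := hγ.trans_le hγτ
  have hm' : (1 : ℝ) ≤ m := by exact_mod_cast hm
  have hd : 0 < dim m := by unfold dim; linarith
  have hV : (1 : ℝ) ≤ ((support R γ m).ncard : ℝ) := by
    have : 0 < (support R γ m).ncard :=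
      (Set.ncard_pos (Set.finite_range _)).2 (Set.range_nonempty _)
    exact_mod_cast this
  have hlog : 1 / 2 ≤ Real.log (1 + ((support R γ m).ncard : ℝ)) := by
    have h1 : Real.log 2 ≤ Real.log (1 + ((support R γ m).ncard : ℝ)) :=
      Real.log_le_log two_pos (by linarith)
    linarith [Real.log_two_gt_d9]
  set ell := Real.log (1 + ((support R γ m).ncard : ℝ)) with hell
  have hell0 : 0 < ell := by linarith
  set A := ell / δ * (C * R ^ 2 * dim m ^ 2 / (γ ^ 2 * τ ^ 2 * θ τ)) with hA
  have hA0 : 0 < A := by positivity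
  have hexp : Real.exp (-logFactor C R γ m δ θ τ) ≤ A⁻¹ := by
    rw [← Real.exp_log hA0, ← Real.exp_neg]
    exact Real.exp_le_exp.2 (neg_le_neg (le_max_right _ _))
  calc _ ≤ 32 * (m * R ^ 2) / τ ^ 4 / θ τ * (2 * A⁻¹) := by gcongr
    _ = δ * (16 / C * ((γ / τ) ^ 2 * (1 / (m * ell)))) := by
        rw [hA, dim]; field_simp; ring
    _ ≤ δ * (16 / C * (1 * 2)) := by
        gcongr
        · exact pow_le_one₀ (by positivity) ((div_le_one hτ).2 hγτ)
        · rw [div_le_iff₀ (by positivity)]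
          nlinarith
    _ ≤ δ * 1 := by
        gcongr
        rw [div_mul_eq_mul_div, div_le_one (by positivity)]
        linarith
    _ = δ := mul_one δ

theorem codebookLaw_fisherTerm_gt_le_failureProb {C : ℝ} (hC : 48 + subgammaConst 6 ≤ C) {m : ℕ}
    (hm : 1 ≤ m) (hR : 0 < R) (hγ : 0 < γ) (hγR : γ < R / 2) {δ : ℝ} (hδ : 0 < δ) {θ : ℝ → ℝ}
    {τ : ℝ} (hγτ : γ ≤ τ) (hθ : 0 < θ τ) {n : ℕ} (hn : 1 ≤ n)
    (hrate : upperRate C R γ m δ θ τ ≤ rate m n) :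
    codebookLaw R γ m n {S | θ τ < fisherTerm R γ τ S} ≤ ENNReal.ofReal δ := by
  have hτ : 0 < τ := hγ.trans_le hγτ
  have hK := subgammaConst_pos 6
  set K := subgammaConst 6
  have hC0 : 0 < C := by linarith
  have hm' : (1 : ℝ) ≤ m := by exact_mod_cast hm
  have hd : 0 < dim m := by unfold dim; linarith
  have hn' : (0 : ℝ) < n := by exact_mod_cast hn
  have hEmin := le_min_err hC0.le hR hγ hγR hm hγτ δ θ
  have hInfo := block_mean_le_infoRate hR hγ hγR hm hγτ
  have hfinal := exp_neg_logFactor_le (by linarith) hR hγ hm hγτ hδ hθ (C := C)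
  have hH1 : 1 ≤ logFactor C R γ m δ θ τ := le_max_left _ _
  set H := logFactor C R γ m δ θ τ
  set σ := min 1 (R / τ) with hσ
  have hσ0 : 0 < σ := lt_min one_pos (by positivity)
  set μ := ∫ p, blockLogRatio R γ τ⁻¹ p ∂(blockLaw R γ)
  set b := σ * Real.sqrt (dim m) + Real.sqrt H with hb
  have hH0 : 0 < Real.sqrt H := Real.sqrt_pos.2 (by linarith)
  have hHsq : Real.sqrt H ^ 2 = H := Real.sq_sqrt (by linarith)
  have hdsq : Real.sqrt (dim m) ^ 2 = dim m := Real.sq_sqrt hd.le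
  have hd0 : 0 ≤ Real.sqrt (dim m) := Real.sqrt_nonneg _
  have hb0 : 0 < b := by positivity
  have hbH : σ * Real.sqrt (dim m * H) + H = Real.sqrt H * b := by
    rw [Real.sqrt_mul hd.le, hb]
    linear_combination -hHsq
  rw [hbH] at hEmin
  -- Half of the rate margin is spent on the deviation `t` of the information density and half on
  -- making `λ / n` small, where `λ = exp (m μ + t)`.
  set t := C / 2 * (Real.sqrt H * b) with ht
  -- Near-optimal Chernoff parameter: `b ≥ √H` keeps `s ≤ 1/8`, `s t = C H / 16`, and `b ≥ σ √d`
  -- bounds the variance term by `K H / 128`.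
  set s := 1 / 8 * (Real.sqrt H / b) with hs
  have hs0 : 0 ≤ s := by positivity
  have hsle : s ≤ 1 / 8 := by
    rw [hs]
    refine mul_le_of_le_one_right (by norm_num) ((div_le_one hb0).2 ?_)
    rw [hb]; exact le_add_of_nonneg_left (by positivity)
  have hHb : H ≤ Real.sqrt H * b := by
    rw [← hbH]; exact le_add_of_nonneg_left (by positivity)
  have hlogn : m * μ - 4 + 2 * t ≤ Real.log n := by
    rw [upperRate, rate, ← mul_le_mul_iff_right₀ hd, mul_div_cancel₀ _ hd.ne', mul_add,
      mul_div_cancel₀ _ hd.ne'] at hrate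
    have : 2 * t = C * (Real.sqrt H * b) := by rw [ht]; ring
    linarith
  have hlam : Real.exp (m * μ + t) / n ≤ Real.exp (-H) := by
    rw [← Real.exp_log hn', ← Real.exp_sub]
    apply Real.exp_le_exp.2
    -- The additive 4 from the change of noise level is absorbed because `H ≥ 1` and `C ≥ 48`.
    have : C / 2 * H ≤ t := by rw [ht]; gcongr
    nlinarith
  have htail : signalNoise R γ m τ {p | Real.log (Real.exp (m * μ + t)) <
      logRatio R γ τ p.1 (p.1 + p.2)} ≤ ENNReal.ofReal (Real.exp (-H)) := by
    rw [Real.log_exp]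
    refine (signalNoise_tail_le hR hγ m hγτ hs0 hsle t).trans
      (ENNReal.ofReal_le_ofReal (Real.exp_le_exp.2 ?_))
    have h1 : s * t = C / 16 * H := by
      have : s * t = C / 16 * Real.sqrt H ^ 2 := by rw [hs, ht]; field_simp; ring
      rw [this, hHsq]
    have h2 : m * (K * s ^ 2 * σ ^ 2) ≤ K / 128 * H := by
      have h3 : dim m * σ ^ 2 ≤ b ^ 2 := by
        calc dim m * σ ^ 2 = (σ * Real.sqrt (dim m)) ^ 2 := by rw [mul_pow, hdsq]; ring
          _ ≤ b ^ 2 := by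
            rw [hb]; gcongr; exact le_add_of_nonneg_right hH0.le
      have h4 : m * (K * s ^ 2 * σ ^ 2) = K / 128 * H * (dim m * σ ^ 2 / b ^ 2) := by
        have : m * (K * s ^ 2 * σ ^ 2) =
            K / 128 * Real.sqrt H ^ 2 * (dim m * σ ^ 2 / b ^ 2) := by
          rw [hs, dim]; field_simp; ring
        rw [this, hHsq]
      rw [h4]
      exact mul_le_of_le_one_right (by positivity) ((div_le_one (by positivity)).2 h3)
    rw [h1]
    nlinarith
  refine (codebookLaw_fisherTerm_gt_le hR hγ hτ hθ hn (Real.exp_pos (m * μ + t))).trans ?_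
  calc _ ≤ ENNReal.ofReal (32 * (m * R ^ 2) / τ ^ 4 / θ τ) *
        (ENNReal.ofReal (Real.exp (-H)) + ENNReal.ofReal (Real.exp (-H))) := by
        gcongr
    _ = ENNReal.ofReal (32 * (m * R ^ 2) / τ ^ 4 / θ τ * (2 * Real.exp (-H))) := by
        rw [← ENNReal.ofReal_add (Real.exp_pos _).le (Real.exp_pos _).le,
          ← ENNReal.ofReal_mul (by positivity)]
        congr 2
        ring
    _ ≤ ENNReal.ofReal δ := ENNReal.ofReal_le_ofReal hfinal

end HardFamily

end

open HardFamily in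
theorem mainTheorem7 :
    ∃ C₀ : ℝ, 0 < C₀ ∧ ∃ d₀ : ℕ, ∀ C : ℝ, C₀ ≤ C →
      ∀ m : ℕ, d₀ ≤ 2 * m →
      ∀ R γ : ℝ, 0 < R → 0 < γ → γ < R / 2 →
      ∀ (Q : ℕ) (ρ : ℝ), 1 ≤ Q → 0 < ρ → ρ < 1 / 4 →
      ∀ ζ θ : ℝ → ℝ,
        (∀ t, γ ≤ t → 0 < ζ t ∧ ζ t ≤ 1 / 2) →
        (∀ t, γ ≤ t → 0 < θ t) →
      ∀ τ : ℝ, γ ≤ τ →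
      ∀ n : ℕ, 1 ≤ n →
        upperRate C R γ m (failureProb ρ Q) θ τ ≤ rate m n →
        codebookLaw R γ m n {S | θ τ < fisherTerm R γ τ S}
            ≤ ENNReal.ofReal (failureProb ρ Q) ∧
        ∀ x : Space m,
          codebookLaw R γ m n {S | oracle R γ ζ θ τ S x ≠ score (nullLaw R γ m) τ x}
            ≤ ENNReal.ofReal (failureProb ρ Q) := by
  refine ⟨48 + subgammaConst 6, by linarith [subgammaConst_pos 6], 2, ?_⟩
  intro C hC m hm R γ hR hγ hγR Q ρ hQ hρ _ ζ θ _ hθ τ hγτ n hn hrate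
  have hδ : 0 < failureProb ρ Q := by
    have : (0 : ℝ) < Q := by exact_mod_cast hQ
    unfold failureProb; positivity
  have key := codebookLaw_fisherTerm_gt_le_failureProb hC (by omega) hR hγ hγR hδ hγτ
    (hθ τ hγτ) hn hrate
  refine ⟨key, fun x => (measure_mono fun S hS => ?_).trans key⟩
  by_contra hle
  -- On `J_τ(S) ≤ θ(τ)` the oracle is the null score by definition, so disagreement implies the
  -- event already bounded.
  exact hS (if_pos (not_lt.1 hle))
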